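/- A \emph{clause} is a finite set of literals containing no complementary pair, and a CNF formula is a finite set of clauses. Let $\mathrm{Krom}$ be the class of CNF formulas all of whose clauses have at most two literals, and $\mathrm{Horn}$ the class of CNF formulas all of whose clauses have at most one positive literal. Let $\mathcal I=\{x_1,\dots,x_n\}$ be a finite set of propositional variables (issues) and let $\Gamma$ be a CNF formula (the integrity constraint), which may also contain variables outside $\mathcal I$. A ballot is a map $r:\mathcal I\to\{0,1\}$; a partial ballot is a map $s:\mathcal I\to\{0,1,\star\}$, and $s$ agrees with $r$ if $s(x)=r(x)$ whenever $s(x)\ne\star$. A (partial) ballot is consistent with $\Gamma$ if some satisfying assignment of $\Gamma$ has the values that it prescribes; a ballot consistent with $\Gamma$ is called rational. A profile is a non-empty finite sequence $\boldsymbol r$ of rational ballots. Let $<_{\mathrm{tb}}$ be a linear order on the $2n$ literals over $\mathcal I$. The majority strength $\mathrm{ms}(\boldsymbol r,l)$ of a literal $l$ is the number of ballots in $\boldsymbol r$ that make $l$ true. Put $l<_{\boldsymbol r}l'$ if $\mathrm{ms}(\boldsymbol r,l)>\mathrm{ms}(\boldsymbol r,l')$, or $\mathrm{ms}(\boldsymbol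 r,l)=\mathrm{ms}(\boldsymbol r,l')$ and $l<_{\mathrm{tb}}l'$. Let $l_1<_{\boldsymbol r}\dots<_{\boldsymbol r}l_{2n}$ be all the literals over $\mathcal I$, let $s_0$ be the partial ballot that is $\star$ everywhere, and for $i=1,\dots,2n$ let $s_i$ be obtained from $s_{i-1}$ by setting $l_i$ to true, if $l_i$ is not false under $s_{i-1}$ and the result is consistent with $\Gamma$, and let $s_i=s_{i-1}$ otherwise. The ranked agenda (Tideman) procedure returns $\mathrm{Tideman}(\boldsymbol r)=\{r^*\}$ with $r^*=s_{2n}$. The problem $\mathrm{Outcome}(\mathrm{Tideman})$ is the following. Instance: issues $\mathcal I$ (variable names written in binary), an integrity constraint $\Gamma$, a tie-breaking order $<_{\mathrm{tb}}$ (given as a list of the literals over $\mathcal I$), a profile $\boldsymbol r$ and a partial ballot $s$. Question: is there a ballot $r^*\in\mathrm{Tideman}(\boldsymbol r)$ such that $s$ agrees with $r^*$? \textbf{Corollary.} For each $\mathcal C\in\{\mathrm{Krom},\mathrm{Horn}\}$, the problem $\mathrm{Outcome}(\mathrm{Tideman})$ restricted to instances with $\Gamma\in\mathcal C$ is solvable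 in polynomial time, i.e. there is a Turing machine that answers every such instance correctly in a number of steps bounded by a polynomial in the length of the encoded instance. -/

import Mathlib

/-- A literal over propositional variables named by natural numbers:
`⟨x, true⟩` is the positive literal `x`, and `⟨x, false⟩` is the negative literal `¬ x`. -/
structure Literal where
  var : ℕ
  sign : Bool
deriving DecidableEq

/-- A clause: a finite set of literals, written down as a list without repetitions, that contains
no complementary pair of literals. -/
structure Clause where
  lits : List Literal
  nodup : lits.Nodup
  no_compl : ∀ x, ¬ (⟨x, true⟩ ∈ lits ∧ ⟨x, false⟩ ∈ lits)

/-- A formula in conjunctive normal form: a finite collection of clauses. -/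
abbrev CNF := List Clause

/-- A clause is true if one of its literals is. -/
def Clause.Holds (c : Clause) (τ : ℕ → Bool) : Prop := ∃ l ∈ c.lits, τ l.var = l.sign

/-- A CNF formula is true if all of its clauses are. -/
def CNF.Holds (φ : CNF) (τ : ℕ → Bool) : Prop := ∀ c ∈ φ, Clause.Holds c τ

/-- Krom (2CNF) formulas: every clause has at most two literals. -/
def Krom : Set CNF := {φ | ∀ c ∈ φ, c.lits.length ≤ 2}

/-- Horn formulas: every clause has at most one positive literal. -/
def Horn : Set CNF := {φ | ∀ c ∈ φ, (c.lits.filter (fun l => l.sign)).length ≤ 1}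

/-- A ballot on `n` issues. -/
abbrev Ballot (n : ℕ) := Fin n → Bool

/-- A partial ballot on `n` issues; `none` plays the role of `⋆`. -/
abbrev PartialBallot (n : ℕ) := Fin n → Option Bool

/-- A literal over `n` issues: the issue and the sign. -/
abbrev IssueLit (n : ℕ) := Fin n × Bool

/-- The partial ballot `s` agrees with the ballot `r`. -/
def PartialBallot.Agrees {n : ℕ} (s : PartialBallot n) (r : Ballot n) : Prop :=
  ∀ i b, s i = some b → r i = b

/-- The partial ballot `s` on the issues `issue 0, …, issue (n - 1)` is consistent with `Γ`:
some truth assignment to all variables satisfies `Γ` and has the values that `s` prescribes.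
(The variables of `Γ` need not all be issues.) -/
def PartialBallot.Consistent {n : ℕ} (issue : Fin n → ℕ) (Γ : CNF) (s : PartialBallot n) : Prop :=
  ∃ τ : ℕ → Bool, (∀ i b, s i = some b → τ (issue i) = b) ∧ CNF.Holds Γ τ

/-- The rational ballots: those consistent with the integrity constraint. -/
def RationalBallots {n : ℕ} (issue : Fin n → ℕ) (Γ : CNF) : Set (Ballot n) :=
  {r | PartialBallot.Consistent issue Γ (fun i => some (r i))}

/-- The majority strength of a literal: the number of ballots of the profile that make it true. -/
def majorityStrength {n : ℕ} (profile : List (Ballot n)) (l : IssueLit n) : ℕ :=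
  profile.countP (fun r => r l.1 == l.2)

/-- The order on literals by descending majority strength, where ties are broken by the
position in the list `tb` (reflexive version). -/
def strengthLE {n : ℕ} (tb : List (IssueLit n)) (profile : List (Ballot n))
    (l₁ l₂ : IssueLit n) : Prop :=
  majorityStrength profile l₁ > majorityStrength profile l₂ ∨
    (majorityStrength profile l₁ = majorityStrength profile l₂ ∧ tb.idxOf l₁ ≤ tb.idxOf l₂)

open Classical in
/-- All literals over the issues (the entries of `tb`), from first to last with respect to
`strengthLE`. -/
noncomputable def rankedLits {n : ℕ} (tb : List (IssueLit n)) (profile : List (Ballot n)) :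
    List (IssueLit n) :=
  tb.mergeSort (fun l₁ l₂ => decide (strengthLE tb profile l₁ l₂))

open Classical in
/-- One step of the ranked agenda procedure: set the literal `l` to true, unless it is already
false or the resulting partial ballot is inconsistent with `Γ`. -/
noncomputable def tidemanStep {n : ℕ} (issue : Fin n → ℕ) (Γ : CNF)
    (s : PartialBallot n) (l : IssueLit n) : PartialBallot n :=
  if s l.1 ≠ some (!l.2) ∧
      PartialBallot.Consistent issue Γ (Function.update s l.1 (some l.2))
  then Function.update s l.1 (some l.2) else s

/-- The ranked agenda (Tideman) procedure with tie-breaking order `tb`: start with the empty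
partial ballot, run through all literals in the order of `rankedLits`, and return the ballot that
has been constructed. -/
noncomputable def Tideman {n : ℕ} (issue : Fin n → ℕ) (Γ : CNF) (tb : List (IssueLit n))
    (profile : List (Ballot n)) : Set (Ballot n) :=
  {r | (rankedLits tb profile).foldl (tidemanStep issue Γ) (fun _ => none)
        = fun i => some (r i)}

/-- An instance of the outcome determination problem for the ranked agenda procedure. -/
structure OutcomeInstance where
  /-- the number of issues -/
  n : ℕ
  /-- the issues, which are pairwise distinct propositional variables -/
  issue : Fin n → ℕ
  issue_injective : Function.Injective issue
  /-- the integrity constraint -/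
  constraint : CNF
  /-- the tie-breaking order, as a list of all literals over the issues -/
  tb : List (IssueLit n)
  tb_nodup : tb.Nodup
  tb_complete : ∀ l, l ∈ tb
  /-- the profile, a non-empty sequence of rational ballots -/
  profile : List (Ballot n)
  profile_ne_nil : profile ≠ []
  profile_rational : ∀ r ∈ profile, r ∈ RationalBallots issue constraint
  /-- the partial ballot that the outcome should agree with -/
  target : PartialBallot n

/-- The question: is there an outcome that agrees with the given partial ballot? -/
def OutcomeTideman (I : OutcomeInstance) : Prop :=
  ∃ r ∈ Tideman I.issue I.constraint I.tb I.profile, PartialBallot.Agrees I.target r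

/-- The input alphabet: binary digits, `⋆`, the two signs of literals, and markers. -/
inductive InputSym
  | bit (b : Bool)
  | star
  | sign (b : Bool)
  | issue
  | clause
  | ballot
  | sep
deriving DecidableEq

/-- Names of variables are written in binary (least significant digit first). -/
def encodeVar (x : ℕ) : List InputSym := (Computability.encodeNat x).map InputSym.bit

/-- A literal: the sign, then the name of the variable. -/
def encodeLiteral (l : Literal) : List InputSym := InputSym.sign l.sign :: encodeVar l.var

/-- A formula: every clause is a marker followed by the literals of the clause. -/
def encodeCNF (φ : CNF) : List InputSym :=
  φ.flatMap (fun c => InputSym.clause :: c.lits.flatMap encodeLiteral)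

/-- An entry of a partial ballot. -/
def encodeEntry : Option Bool → InputSym
  | some b => InputSym.bit b
  | none => InputSym.star

/-- An instance as a word: the issues, the integrity constraint, the tie-breaking order, the
profile, and the partial ballot. -/
def OutcomeInstance.encode (I : OutcomeInstance) : List InputSym :=
  (List.ofFn I.issue).flatMap (fun x => InputSym.issue :: encodeVar x) ++ [InputSym.sep] ++
  encodeCNF I.constraint ++ [InputSym.sep] ++
  I.tb.flatMap (fun l => encodeLiteral ⟨I.issue l.1, l.2⟩) ++ [InputSym.sep] ++
  I.profile.flatMap (fun r => InputSym.ballot :: (List.ofFn r).map InputSym.bit) ++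
    [InputSym.sep] ++
  (List.ofFn I.target).map encodeEntry

open Classical in
/-- The decision problem with the instances `α`, encoded as words by `enc`, and the question `Q`
is solved by a Turing machine whose running time is bounded by a polynomial in the length of the
encoded instance. -/
def PolyTimeSolvable {α A : Type} (enc : α → List A) (Q : α → Prop) : Prop :=
  Nonempty (Turing.TM2ComputableInPolyTime enc Computability.encodeBool (fun a => decide (Q a)))

/-!
# The ranked agenda procedure runs in polynomial time for Krom and Horn constraints

The ranked agenda procedure runs through the literals by descending majority strength and sets a
literal to true whenever the resulting partial ballot is consistent with the integrity constraint
`Γ`. All that has to be decided is thus whether `Γ` is satisfiable together with a set of unit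
literals. Unit propagation does this for both classes. For, suppose that it stops without a
conflict. Then every clause that is not yet satisfied has at least two literals that are not
falsified. If `Γ` is a Krom formula, then these are all the literals of the clause, and none of its
variables has received a value; so any satisfying assignment of `Γ` takes care of all these clauses,
and there is one, because a profile is non-empty and consists of rational ballots. If `Γ` is a Horn
formula, then one of the two literals is negative, and it suffices to make all remaining variables
false. This is `conflictFree_closure_iff`. As the partial ballot remains consistent, the procedure
ends with a total ballot (`foldl_tidemanStep_ne_none`), and a target agrees with it if and only if
all literals of the target have been set to true (`outcomeTideman_iff_answer`). The order of the
literals is obtained without sorting: for each threshold, from the number of ballots down to zero,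
list the literals of that majority strength in the tie-breaking order (`ranked_eq_rankedLits`).

The algorithm is a functional program on lists, built from folds, maps, filters and case
distinctions, and `PolyTime` is a class of functions that is closed under these constructions. Data
are coded by binary trees, and a tree by its preorder word, which is self-delimiting. A function is
in the class if some program with a fixed number of stacks replaces the word of the argument on top
of the main stack by the word of the value, whatever lies below, in polynomially many steps. Since
the words below are not touched, programs can be nested freely. The constructions that need care are
folds: there the intermediate states have to be of polynomial size (`PolyTime.foldl_of_size_le`),
which holds if every step adds a polynomial amount (`PolyTime.foldl`). The stack programs are
structured programs with loops, and they are compiled to Turing machines with the same number of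
steps (`StackProg.Exec.steps`, `polyTimeSolvable_of_polyTime`).
-/

/-! ### A structured language of stack programs -/

/-- Structured programs over finitely many stacks, where `Γ k` is the alphabet of the stack `k`. -/
inductive StackProg {K : Type} (Γ : K → Type) : Type
  /-- do nothing -/
  | skip : StackProg Γ
  /-- push the symbol `a` on the stack `k` -/
  | push (k : K) (a : Γ k) : StackProg Γ
  /-- pop the stack `k` and branch on the symbol that was found (`none` if `k` was empty) -/
  | pop (k : K) (p : Option (Γ k) → StackProg Γ) : StackProg Γ
  /-- sequential composition -/
  | seq (p q : StackProg Γ) : StackProg Γ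
  /-- repeat `p` as long as the top of the stack `k` (`none` if `k` is empty) passes the test -/
  | loop (k : K) (test : Option (Γ k) → Bool) (p : StackProg Γ) : StackProg Γ

namespace StackProg

open Turing Function

variable {K : Type} {Γ : K → Type}

/-- The labels of the machine code for a program. -/
def Label : StackProg Γ → Type
  | skip => Unit
  | push _ _ => Unit
  | pop _ p => Option (Σ o, Label (p o))
  | seq p q => Label p ⊕ Label q
  | loop _ _ p => Option (Label p)

/-- There are finitely many labels. -/
@[reducible] noncomputable def labelFintype [∀ k, Fintype (Γ k)] :
    (p : StackProg Γ) → Fintype (Label p)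
  | skip => inferInstanceAs (Fintype Unit)
  | push _ _ => inferInstanceAs (Fintype Unit)
  | pop _ p =>
      haveI := fun o => labelFintype (p o)
      inferInstanceAs (Fintype (Option (Σ o, Label (p o))))
  | seq p q =>
      haveI := labelFintype p
      haveI := labelFintype q
      inferInstanceAs (Fintype (Label p ⊕ Label q))
  | loop _ _ p =>
      haveI := labelFintype p
      inferInstanceAs (Fintype (Option (Label p)))

/-- The label at which a program starts. -/
def entry : (p : StackProg Γ) → Label p
  | skip => ()
  | push _ _ => ()
  | pop _ _ => none
  | seq p _ => Sum.inl (entry p)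
  | loop _ _ _ => none

variable [DecidableEq K]

/-- The machine code for a program inside a machine with labels `Λ`: the labels of the program are
placed by `emb`, and control is passed on to `exit` at the end. The internal memory of the machine
holds the symbols that were read last. -/
def code {Λ : Type} : (p : StackProg Γ) → (Label p → Λ) → Λ → Label p →
    TM2.Stmt Γ Λ (∀ k, Option (Γ k))
  | skip, _, exit, _ => .goto fun _ => exit
  | push k a, _, exit, _ => .push k (fun _ => a) (.goto fun _ => exit)
  | pop k p, emb, _, none =>
      .pop k (fun v o => update v k o) (.goto fun v => emb (some ⟨v k, entry (p (v k))⟩))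
  | pop _ p, emb, exit, some ⟨o, l⟩ => code (p o) (fun l => emb (some ⟨o, l⟩)) exit l
  | seq p q, emb, _, Sum.inl l => code p (fun l => emb (Sum.inl l)) (emb (Sum.inr (entry q))) l
  | seq _ q, emb, exit, Sum.inr l => code q (fun l => emb (Sum.inr l)) exit l
  | loop k test p, emb, exit, none =>
      .peek k (fun v o => update v k o)
        (.goto fun v => if test (v k) then emb (some (entry p)) else exit)
  | loop _ _ p, emb, _, some l => code p (fun l => emb (some l)) (emb none) l

/-- `Exec p S S' t`: started with the stacks `S`, the program `p` ends with the stacks `S'`, and its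
machine code takes `t` steps. -/
inductive Exec : StackProg Γ → (∀ k, List (Γ k)) → (∀ k, List (Γ k)) → ℕ → Prop
  | skip {S} : Exec skip S S 1
  | push {k a S} : Exec (push k a) S (update S k (a :: S k)) 1
  | pop {k p S S' t} (h : Exec (p (S k).head?) (update S k (S k).tail) S' t) :
      Exec (pop k p) S S' (t + 1)
  | seq {p q S₁ S₂ S₃ t₁ t₂} (h₁ : Exec p S₁ S₂ t₁) (h₂ : Exec q S₂ S₃ t₂) :
      Exec (seq p q) S₁ S₃ (t₁ + t₂)
  | loop_false {k test p S} (h : test (S k).head? = false) : Exec (loop k test p) S S 1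
  | loop_true {k test p S₁ S₂ S₃ t₁ t₂} (h : test (S₁ k).head? = true) (h₁ : Exec p S₁ S₂ t₁)
      (h₂ : Exec (loop k test p) S₂ S₃ t₂) : Exec (loop k test p) S₁ S₃ (t₁ + t₂ + 1)

/-- Wherever its code is placed in a machine `M`, a program is executed faithfully. -/
theorem Exec.steps {Λ : Type} {M : Λ → TM2.Stmt Γ Λ (∀ k, Option (Γ k))} {p : StackProg Γ}
    {S S' : ∀ k, List (Γ k)} {t : ℕ} (h : Exec p S S' t) (emb : Label p → Λ) (exit : Λ)
    (hM : ∀ l, M (emb l) = code p emb exit l) (v : ∀ k, Option (Γ k)) :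
    ∃ v', (flip bind (TM2.step M))^[t] (some ⟨some (emb (entry p)), v, S⟩) =
      some ⟨some exit, v', S'⟩ := by
  induction h generalizing exit v with
  | skip => exact ⟨v, by simp [flip, hM, code]⟩
  | push => exact ⟨v, by simp [flip, hM, code]⟩
  | @pop k p S S' t _ ih =>
    have h₀ : M (emb none) = .pop k (fun v o => update v k o)
      (.goto fun v => emb (some ⟨v k, entry (p (v k))⟩)) := hM none
    obtain ⟨v', hv'⟩ := ih (fun l => emb (some ⟨(S k).head?, l⟩)) exit
      (fun l => hM (some ⟨(S k).head?, l⟩)) (update v k (S k).head?)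
    refine ⟨v', ?_⟩
    have key : ∀ o, o = (S k).head? → emb (some ⟨o, entry (p o)⟩) =
      emb (some ⟨(S k).head?, entry (p (S k).head?)⟩) := by rintro _ rfl; rfl
    rw [iterate_succ_apply, ← hv']
    simp [flip, entry, h₀, key _ (update_self k _ v)]
  | @seq p q S₁ S₂ S₃ t₁ t₂ _ _ ih₁ ih₂ =>
    obtain ⟨v₁, h₁⟩ := ih₁ (fun l => emb (Sum.inl l)) (emb (Sum.inr (entry q)))
      (fun l => hM (Sum.inl l)) v
    obtain ⟨v₂, h₂⟩ := ih₂ (fun l => emb (Sum.inr l)) exit (fun l => hM (Sum.inr l)) v₁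
    exact ⟨v₂, by rw [add_comm, iterate_add_apply]; exact (congrArg _ h₁).trans h₂⟩
  | @loop_false k test p S h =>
    have h₀ : M (emb none) = .peek k (fun v o => update v k o)
      (.goto fun v => if test (v k) then emb (some (entry p)) else exit) := hM none
    exact ⟨update v k (S k).head?, by simp [flip, entry, h₀, h]⟩
  | @loop_true k test p S₁ S₂ S₃ t₁ t₂ h _ _ ih₁ ih₂ =>
    have h₀ : M (emb none) = .peek k (fun v o => update v k o)
      (.goto fun v => if test (v k) then emb (some (entry p)) else exit) := hM none
    obtain ⟨v₁, h₁⟩ := ih₁ (fun l => emb (some l)) (emb none) (fun l => hM (some l))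
      (update v k (S₁ k).head?)
    obtain ⟨v₂, h₂⟩ := ih₂ emb exit hM v₁
    refine ⟨v₂, ?_⟩
    rw [iterate_succ_apply, add_comm, iterate_add_apply, ← h₂]
    refine congrArg _ (Eq.trans ?_ h₁)
    simp [flip, entry, h₀, h]

/-- A step pushes at most one symbol. -/
theorem Exec.length_le [Fintype K] {p : StackProg Γ} {S S' : ∀ k, List (Γ k)} {t : ℕ}
    (h : Exec p S S' t) : ∑ k, (S' k).length ≤ ∑ k, (S k).length + t := by
  have upd (S : ∀ k, List (Γ k)) (k : K) (l : List (Γ k)) (n : ℕ)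
      (hl : l.length ≤ (S k).length + n) :
      ∑ j, (update S k l j).length ≤ ∑ j, (S j).length + n := by
    rw [← Finset.add_sum_erase _ _ (Finset.mem_univ k),
      ← Finset.add_sum_erase (a := k) _ (fun j => (S j).length) (Finset.mem_univ k), update_self,
      Finset.sum_congr rfl fun j hj => by rw [update_of_ne (Finset.ne_of_mem_erase hj)]]
    omega
  induction h with
  | skip => omega
  | @push k a S => exact upd S k _ 1 (by simp)
  | @pop k p S S' t _ ih => exact ih.trans (by have := upd S k (S k).tail 0 (by simp); omega)
  | seq _ _ ih₁ ih₂ => omega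
  | loop_false => omega
  | loop_true _ _ _ ih₁ ih₂ => omega

/-- The program `p` leads from the stacks `S` to the stacks `S'` in at most `n` steps. -/
def Runs (p : StackProg Γ) (S S' : ∀ k, List (Γ k)) (n : ℕ) : Prop := ∃ t ≤ n, Exec p S S' t

theorem Runs.mono {p : StackProg Γ} {S S' : ∀ k, List (Γ k)} {m n : ℕ} (h : Runs p S S' m)
    (hmn : m ≤ n) : Runs p S S' n :=
  let ⟨t, ht, e⟩ := h; ⟨t, ht.trans hmn, e⟩

theorem Runs.skip {S : ∀ k, List (Γ k)} : Runs skip S S 1 := ⟨1, le_rfl, .skip⟩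

theorem Runs.push {k : K} {a : Γ k} {S : ∀ k, List (Γ k)} :
    Runs (push k a) S (update S k (a :: S k)) 1 := ⟨1, le_rfl, .push⟩

theorem Runs.pop {k : K} {p : Option (Γ k) → StackProg Γ} {S S' : ∀ k, List (Γ k)} {n : ℕ}
    (h : Runs (p (S k).head?) (update S k (S k).tail) S' n) : Runs (pop k p) S S' (n + 1) :=
  let ⟨t, ht, e⟩ := h; ⟨t + 1, by omega, .pop e⟩

theorem Runs.seq {p q : StackProg Γ} {S₁ S₂ S₃ : ∀ k, List (Γ k)} {m n : ℕ}
    (h₁ : Runs p S₁ S₂ m) (h₂ : Runs q S₂ S₃ n) : Runs (seq p q) S₁ S₃ (m + n) :=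
  let ⟨t₁, ht₁, e₁⟩ := h₁; let ⟨t₂, ht₂, e₂⟩ := h₂; ⟨t₁ + t₂, by omega, .seq e₁ e₂⟩

theorem Runs.loop_false {k : K} {test : Option (Γ k) → Bool} {p : StackProg Γ}
    {S : ∀ k, List (Γ k)} (h : test (S k).head? = false) : Runs (loop k test p) S S 1 :=
  ⟨1, le_rfl, .loop_false h⟩

theorem Runs.loop_true {k : K} {test : Option (Γ k) → Bool} {p : StackProg Γ}
    {S₁ S₂ S₃ : ∀ k, List (Γ k)} {m n : ℕ} (h : test (S₁ k).head? = true) (h₁ : Runs p S₁ S₂ m)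
    (h₂ : Runs (loop k test p) S₂ S₃ n) : Runs (loop k test p) S₁ S₃ (m + n + 1) :=
  let ⟨t₁, ht₁, e₁⟩ := h₁; let ⟨t₂, ht₂, e₂⟩ := h₂; ⟨t₁ + t₂ + 1, by omega, .loop_true h e₁ e₂⟩

/-- The machine that executes the program `p`, with input on the stack `k₀` and output on the
stack `k₁`. -/
noncomputable def machine [Fintype K] [∀ k, Fintype (Γ k)] (p : StackProg Γ) (k₀ k₁ : K) :
    FinTM2 where
  K := K
  k₀ := k₀
  k₁ := k₁
  Γ := Γ
  Λ := Option (Label p)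
  main := some (entry p)
  ΛFin := haveI := labelFintype p; inferInstanceAs (Fintype (Option (Label p)))
  σ := ∀ k, Option (Γ k)
  initialState := fun _ => none
  m
    | some l => code p some none l
    | none => .load (fun _ _ => none) .halt

theorem initList_eq (tm : FinTM2) (x : List (tm.Γ tm.k₀)) :
    initList tm x = ⟨some tm.main, tm.initialState, update (fun _ => []) tm.k₀ x⟩ := by
  unfold initList
  congr 1
  funext k
  by_cases hk : k = tm.k₀
  · subst hk; rw [update_self]; exact dif_pos rfl
  · rw [update_of_ne hk]; exact dif_neg hk

theorem haltList_eq (tm : FinTM2) (y : List (tm.Γ tm.k₁)) :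
    haltList tm y = ⟨none, tm.initialState, update (fun _ => []) tm.k₁ y⟩ := by
  unfold haltList
  congr 1
  funext k
  by_cases hk : k = tm.k₁
  · subst hk; rw [update_self]; exact dif_pos rfl
  · rw [update_of_ne hk]; exact dif_neg hk

/-- If a program turns the input `x` into the output `y`, so does its machine. -/
theorem Runs.machine_outputs [Fintype K] [∀ k, Fintype (Γ k)] {p : StackProg Γ} {k₀ k₁ : K}
    {x : List (Γ k₀)} {y : List (Γ k₁)} {n m : ℕ}
    (h : Runs p (update (fun _ => []) k₀ x) (update (fun _ => []) k₁ y) n) (hn : n + 1 ≤ m) :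
    Nonempty (TM2OutputsInTime (machine p k₀ k₁) x (some y) m) := by
  obtain ⟨t, ht, e⟩ := h
  obtain ⟨v, hv⟩ := e.steps (M := (machine p k₀ k₁).m) some none (fun _ => rfl) (fun _ => none)
  refine ⟨⟨⟨t + 1, ?_⟩, Nat.le_trans (Nat.succ_le_succ ht) hn⟩⟩
  rw [iterate_succ_apply']
  have h₀ : initList (machine p k₀ k₁) x =
      ⟨some (some (entry p)), fun _ => none, update (fun _ => []) k₀ x⟩ :=
    initList_eq (machine p k₀ k₁) x
  have h₁ : haltList (machine p k₀ k₁) y = ⟨none, fun _ => none, update (fun _ => []) k₁ y⟩ :=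
    haltList_eq (machine p k₀ k₁) y
  exact (congrArg (fun c => flip bind (machine p k₀ k₁).step
    ((flip bind (machine p k₀ k₁).step)^[t] (some c))) h₀).trans
    ((congrArg (flip bind (machine p k₀ k₁).step) hv).trans (congrArg some h₁.symm))

end StackProg

/-! ### Serialized trees on a stack -/

/-- Binary trees, which serve as universal data. -/
inductive BinTree
  | leaf
  | node (l r : BinTree)

/-- The preorder serialization of a tree. It is self-delimiting, so that a serialized tree on top of
a stack can be told apart from what lies below it. -/
def BinTree.bits : BinTree → List Bool
  | leaf => [false]
  | node l r => true :: (l.bits ++ r.bits)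

/-- The stacks of the machines below: an input stack, a main stack, which holds serialized trees,
two auxiliary stacks, and a stack that is used as a counter. -/
inductive WorkStack
  | input
  | main
  | aux (k : Bool)
  | counter
deriving DecidableEq, Fintype

/-- The input stack holds input symbols, the other stacks hold bits. -/
abbrev WorkStack.Alphabet : WorkStack → Type
  | input => InputSym
  | main => Bool
  | aux _ => Bool
  | counter => Bool

/-- Contents of the stacks. -/
def contents (i : List InputSym) (m : List Bool) (x : Bool → List Bool) (c : List Bool) :
    ∀ k : WorkStack, List k.Alphabet
  | .input => i
  | .main => m
  | .aux k => x k
  | .counter => c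

/-- The configuration between two operations: only the main stack is in use. -/
def onMain (m : List Bool) : ∀ k : WorkStack, List k.Alphabet := contents [] m (fun _ => []) []

section

open Function

variable (i : List InputSym) (m : List Bool) (x : Bool → List Bool) (c : List Bool)

@[simp] theorem contents_main : contents i m x c .main = m := rfl
@[simp] theorem contents_input : contents i m x c .input = i := rfl
@[simp] theorem contents_aux (k : Bool) : contents i m x c (.aux k) = x k := rfl
@[simp] theorem contents_counter : contents i m x c .counter = c := rfl

@[simp] theorem update_contents_input (l : List InputSym) :
    update (contents i m x c) .input l = contents l m x c := by
  funext k; cases k <;> rfl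

@[simp] theorem update_contents_main (l : List Bool) :
    update (contents i m x c) .main l = contents i l x c := by
  funext k; cases k <;> rfl

@[simp] theorem update_contents_aux (k : Bool) (l : List Bool) :
    update (contents i m x c) (.aux k) l = contents i m (update x k l) c := by
  funext j
  cases j with
  | aux j =>
    by_cases h : j = k
    · subst h; simp
    · simp [update_of_ne, h]
  | _ => rfl

@[simp] theorem update_contents_counter (l : List Bool) :
    update (contents i m x c) .counter l = contents i m x l := by
  funext k; cases k <;> rfl

end

/-- Programs over the stacks `WorkStack`. -/
abbrev WorkProg := StackProg WorkStack.Alphabet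

namespace WorkProg

open StackProg Function

theorem runs_push_main {b : Bool} {i m x c} :
    Runs (push .main b : WorkProg) (contents i m x c) (contents i (b :: m) x c) 1 := by
  simpa using Runs.push (Γ := WorkStack.Alphabet) (k := .main) (a := b) (S := contents i m x c)

theorem runs_push_aux {k b : Bool} {i m x c} : Runs (push (.aux k) b : WorkProg)
    (contents i m x c) (contents i m (update x k (b :: x k)) c) 1 := by
  simpa using Runs.push (Γ := WorkStack.Alphabet) (k := .aux k) (a := b) (S := contents i m x c)

theorem runs_push_counter {b : Bool} {i m x c} :
    Runs (push .counter b : WorkProg) (contents i m x c) (contents i m x (b :: c)) 1 := by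
  simpa using Runs.push (Γ := WorkStack.Alphabet) (k := .counter) (a := b) (S := contents i m x c)

theorem runs_pop_main {p : Option Bool → WorkProg} {b : Bool} {i m x c S' n}
    (h : Runs (p (some b)) (contents i m x c) S' n) :
    Runs (pop .main p : WorkProg) (contents i (b :: m) x c) S' (n + 1) :=
  Runs.pop (by simpa using h)

theorem runs_pop_counter {p : Option Bool → WorkProg} {b : Bool} {i m x c S' n}
    (h : Runs (p (some b)) (contents i m x c) S' n) :
    Runs (pop .counter p : WorkProg) (contents i m x (b :: c)) S' (n + 1) :=
  Runs.pop (by simpa using h)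

theorem runs_pop_aux {p : Option Bool → WorkProg} {k b : Bool} {i m x c l S' n}
    (h : Runs (p (some b)) (contents i m (update x k l) c) S' n) :
    Runs (pop (.aux k) p : WorkProg) (contents i m (update x k (b :: l)) c) S' (n + 1) :=
  Runs.pop (by simpa using h)

/-- Pop a tree from the main stack, and call `emit` for each of its bits. The height of the counter
is the number of trees that are still to be read. -/
def readLoop (emit : Bool → WorkProg) : WorkProg :=
  loop .counter Option.isSome (pop .main fun
    | some true => seq (emit true) (push .counter true)
    | some false => seq (emit false) (pop .counter fun _ => skip)
    | none => skip)

/-- Pop a tree from the main stack, and call `emit` for each of its bits. -/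
def readTree (emit : Bool → WorkProg) : WorkProg := seq (push .counter true) (readLoop emit)

/-- The counter holds one symbol for every tree that is still to be read, so a loop that starts with
a tree `t` on top of the main stack consumes `t` together with one symbol of the counter. -/
theorem runs_readLoop {emit : Bool → WorkProg} {e : Bool → (Bool → List Bool) → Bool → List Bool}
    (he : ∀ b m x c, Runs (emit b) (contents [] m x c) (contents [] m (e b x) c) 2) (t : BinTree)
    {r c : List Bool} {x : Bool → List Bool} {S' n}
    (h : Runs (readLoop emit) (contents [] r (t.bits.foldl (fun x b => e b x) x) c) S' n) :
    Runs (readLoop emit) (contents [] (t.bits ++ r) x (true :: c)) S' (n + 6 * t.bits.length) := by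
  induction t generalizing r c x n with
  | leaf =>
    refine (Runs.loop_true rfl (runs_pop_main (b := false) ((he _ _ _ _).seq
      (runs_pop_counter .skip))) h).mono ?_
    simp [BinTree.bits]; omega
  | node l r' ihl ihr =>
    have e : (BinTree.node l r').bits ++ r = true :: (l.bits ++ (r'.bits ++ r)) := by
      simp [BinTree.bits]
    rw [e]
    refine (Runs.loop_true rfl (runs_pop_main (b := true) ((he _ _ _ _).seq
      runs_push_counter)) (m := 4) (n := n + 6 * r'.bits.length + 6 * l.bits.length) ?_).mono ?_
    · refine ihl (ihr ?_)
      simpa [BinTree.bits] using h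
    · simp [BinTree.bits]; omega

theorem runs_readTree {emit : Bool → WorkProg} {e : Bool → (Bool → List Bool) → Bool → List Bool}
    (he : ∀ b m x c, Runs (emit b) (contents [] m x c) (contents [] m (e b x) c) 2) (t : BinTree)
    {r : List Bool} {x : Bool → List Bool} :
    Runs (readTree emit) (contents [] (t.bits ++ r) x [])
      (contents [] r (t.bits.foldl (fun x b => e b x) x) []) (6 * t.bits.length + 2) :=
  (runs_push_counter.seq (runs_readLoop he t (n := 1) (.loop_false rfl))).mono (by omega)

/-- Move a tree from the main stack to an auxiliary stack, where it is stored in reverse. -/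
def stash (k : Bool) : WorkProg := readTree fun b => push (.aux k) b

theorem runs_stash (k : Bool) (t : BinTree) {r : List Bool} {x : Bool → List Bool} :
    Runs (stash k) (contents [] (t.bits ++ r) x [])
      (contents [] r (update x k (t.bits.reverse ++ x k)) []) (6 * t.bits.length + 2) := by
  have := runs_readTree (e := fun b x => update x k (b :: x k))
    (fun b m x c => runs_push_aux.mono one_le_two) t (r := r) (x := x)
  have key (l : List Bool) : ∀ x : Bool → List Bool,
      l.foldl (fun x b => update x k (b :: x k)) x = update x k (l.reverse ++ x k) := by
    induction l with
    | nil => simp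
    | cons b l ih => intro x; simp [ih]
  rwa [key] at this

/-- Move everything from an auxiliary stack to the main stack. -/
def unstash (k : Bool) : WorkProg :=
  loop (.aux k) Option.isSome (pop (.aux k) fun
    | some b => push .main b
    | none => skip)

theorem runs_unstash (k : Bool) {m : List Bool} {x : Bool → List Bool} :
    Runs (unstash k) (contents [] m x [])
      (contents [] ((x k).reverse ++ m) (update x k []) []) (3 * (x k).length + 1) := by
  have key (l : List Bool) : ∀ m, Runs (unstash k) (contents [] m (update x k l) [])
      (contents [] (l.reverse ++ m) (update x k []) []) (3 * l.length + 1) := by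
    induction l with
    | nil => exact fun m => .loop_false (by simp)
    | cons b l ih =>
      intro m
      rw [List.reverse_cons, List.append_assoc]
      refine (Runs.loop_true (by simp) (runs_pop_aux (l := l) ?_) (ih (b :: m)) (m := 2)).mono ?_
      · exact runs_push_main
      · simp; omega
  simpa using key (x k) m

/-- Exchange the two topmost trees. -/
def swap : WorkProg := seq (seq (stash false) (stash true)) (seq (unstash false) (unstash true))

theorem runs_swap (s t : BinTree) (r : List Bool) :
    Runs swap (onMain (s.bits ++ (t.bits ++ r))) (onMain (t.bits ++ (s.bits ++ r)))
      (9 * (s.bits.length + t.bits.length) + 6) := by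
  have h := ((runs_stash false s (r := t.bits ++ r) (x := fun _ => [])).seq
    (runs_stash true t)).seq ((runs_unstash false).seq (runs_unstash true))
  have e : (fun _ => []) = update (update (update (update (fun _ : Bool => ([] : List Bool)) false
      s.bits.reverse) true t.bits.reverse) false []) true [] := by
    funext k; cases k <;> simp
  simp only [update_self, List.append_nil, ne_eq, Bool.false_eq_true, not_false_eq_true,
    update_of_ne, reduceCtorEq, List.reverse_reverse, List.length_reverse, ← e] at h
  exact h.mono (by omega)

/-- Duplicate the topmost tree. -/
def dup : WorkProg :=
  seq (readTree fun b => seq (push (.aux false) b) (push (.aux true) b))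
    (seq (unstash false) (unstash true))

theorem runs_dup (t : BinTree) (r : List Bool) :
    Runs dup (onMain (t.bits ++ r)) (onMain (t.bits ++ (t.bits ++ r)))
      (12 * t.bits.length + 4) := by
  have key (l : List Bool) : ∀ x : Bool → List Bool,
      l.foldl (fun x b => update (update x false (b :: x false)) true (b :: x true)) x =
        fun k => l.reverse ++ x k := by
    induction l with
    | nil => simp
    | cons b l ih =>
      intro x
      rw [List.foldl_cons, ih]
      funext k; cases k <;> simp
  have h := (runs_readTree (emit := fun b => seq (push (.aux false) b) (push (.aux true) b))
    (e := fun b x => update (update x false (b :: x false)) true (b :: x true))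
    (fun b m x c => runs_push_aux.seq runs_push_aux) t (r := r)
    (x := fun _ => [])).seq ((runs_unstash false).seq (runs_unstash true))
  have e : (fun _ => []) = update (update (fun _ : Bool => t.bits.reverse) false []) true [] := by
    funext k; cases k <;> simp
  simp only [key, List.append_nil, ne_eq, Bool.true_eq_false, not_false_eq_true,
    update_of_ne, List.reverse_reverse, List.length_reverse, ← e] at h
  exact h.mono (by omega)

/-- Remove the topmost tree. -/
def drop : WorkProg := readTree fun _ => skip

theorem runs_drop (t : BinTree) (r : List Bool) :
    Runs drop (onMain (t.bits ++ r)) (onMain r) (6 * t.bits.length + 2) := by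
  have h := runs_readTree (emit := fun _ => skip) (e := fun _ x => x)
    (fun _ _ _ _ => Runs.skip.mono one_le_two) t (r := r) (x := fun _ => [])
  have key (l : List Bool) (x : Bool → List Bool) : l.foldl (fun x _ => x) x = x := by
    induction l with
    | nil => rfl
    | cons b l ih => exact ih
  rwa [key] at h

/-- Push a word on the main stack. -/
def pushAll : List Bool → WorkProg
  | [] => skip
  | b :: l => seq (pushAll l) (push .main b)

theorem runs_pushAll (l : List Bool) {i m x c} :
    Runs (pushAll l) (contents i m x c) (contents i (l ++ m) x c) (l.length + 1) := by
  induction l with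
  | nil => exact .skip
  | cons b l ih => exact ih.seq runs_push_main

end WorkProg

/-! ### Functions computable in polynomial time -/

/-- Data types whose elements are represented by binary trees. -/
class TreeCode (α : Type) where
  /-- the tree that represents an element -/
  toTree : α → BinTree

namespace TreeCode

/-- The word that represents an element on the main stack. -/
def word {α : Type} [TreeCode α] (a : α) : List Bool := (toTree a).bits

/-- The length of the word that represents an element. -/
def size {α : Type} [TreeCode α] (a : α) : ℕ := (word a).length

variable {α β : Type} [TreeCode α] [TreeCode β]

instance : TreeCode Unit := ⟨fun _ => .leaf⟩

instance : TreeCode Bool := ⟨fun b => if b then .node .leaf .leaf else .leaf⟩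

instance : TreeCode (α × β) := ⟨fun p => .node (toTree p.1) (toTree p.2)⟩

instance : TreeCode (List α) := ⟨fun l => l.foldr (fun a t => .node (toTree a) t) .leaf⟩

@[simp] theorem word_true : word true = [true, false, false] := rfl
@[simp] theorem word_false : word false = [false] := rfl
@[simp] theorem word_pair (a : α) (b : β) : word (a, b) = true :: (word a ++ word b) := rfl
@[simp] theorem word_nil : word ([] : List α) = [false] := rfl
@[simp] theorem word_cons (a : α) (l : List α) : word (a :: l) = true :: (word a ++ word l) := rfl

theorem length_bits_toTree (a : α) : (toTree a).bits.length = size a := rfl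

@[simp] theorem size_pair (a : α) (b : β) : size (a, b) = size a + size b + 1 := by simp [size]
@[simp] theorem size_nil : size ([] : List α) = 1 := rfl
@[simp] theorem size_cons (a : α) (l : List α) : size (a :: l) = size a + size l + 1 := by
  simp [size]

theorem size_bool_le (b : Bool) : size b ≤ 3 := by cases b <;> simp [size]

theorem size_pos (a : α) : 0 < size a := by
  unfold size word
  cases toTree a <;> simp [BinTree.bits]

theorem length_lt_size (l : List α) : l.length < size l := by
  induction l with
  | nil => simp
  | cons a l ih => simp; omega

theorem size_append (l l' : List α) : size (l ++ l') + 1 = size l + size l' := by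
  induction l with
  | nil => simp; omega
  | cons a l ih => simp; omega

theorem size_le_of_mem {a : α} {l : List α} (h : a ∈ l) : size a ≤ size l := by
  induction h with
  | head => simp; omega
  | tail _ _ ih => simp; omega

theorem size_filter_le (l : List α) (q : α → Bool) : size (l.filter q) ≤ size l := by
  induction l with
  | nil => simp
  | cons a l ih =>
    rw [List.filter_cons]
    split <;> simp <;> omega

end TreeCode

theorem Polynomial.monotone_eval_nat (P : Polynomial ℕ) : Monotone fun n => P.eval n := by
  intro m n h
  simp only [Polynomial.eval_eq_sum_range]
  gcongr

open TreeCode StackProg WorkProg in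
/-- The function `f` is computable in polynomial time: some program replaces the word of `a` on top
of the main stack by the word of `f a`, whatever lies below it, and the number of steps is
polynomial in the length of the former. -/
def PolyTime {α β : Type} [TreeCode α] [TreeCode β] (f : α → β) : Prop :=
  ∃ (p : WorkProg) (P : Polynomial ℕ), ∀ a r,
    Runs p (onMain (word a ++ r)) (onMain (word (f a) ++ r)) (P.eval (size a))

namespace PolyTime

open TreeCode StackProg WorkProg Polynomial

variable {α β γ : Type} [TreeCode α] [TreeCode β] [TreeCode γ]

/-- A step makes the main stack at most one symbol longer, so values of functions computable in
polynomial time have polynomial size. -/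
theorem exists_size_le {f : α → β} (hf : PolyTime f) :
    ∃ Q : ℕ[X], ∀ a, size (f a) ≤ Q.eval (size a) := by
  obtain ⟨p, P, h⟩ := hf
  refine ⟨X + P, fun a => ?_⟩
  obtain ⟨t, ht, e⟩ := h a []
  have key (m : List Bool) : ∑ k, (onMain m k).length = m.length :=
    Finset.sum_eq_single WorkStack.main (fun k _ hk => by
      cases k <;> first | rfl | exact absurd rfl hk) (by simp)
  have := e.length_le
  rw [key, key, List.append_nil, List.append_nil] at this
  simp only [eval_add, eval_X]
  exact this.trans (Nat.add_le_add_left ht _)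

theorem of_word_eq {f : α → β} (h : ∀ a, word (f a) = word a) : PolyTime f :=
  ⟨skip, 1, fun a r => by rw [h]; simpa using Runs.skip⟩

theorem id : PolyTime fun a : α => a := of_word_eq fun _ => rfl

theorem const (b : β) : PolyTime fun _ : α => b := by
  refine ⟨seq drop (pushAll (word b)), 6 * X + (C (size b) + 3), fun a r => ?_⟩
  refine ((runs_drop (toTree a) r).seq (runs_pushAll (word b))).mono ?_
  simp [size, word]; omega

theorem comp {g : β → γ} {f : α → β} (hg : PolyTime g) (hf : PolyTime f) :
    PolyTime fun a => g (f a) := by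
  obtain ⟨Q, hQ⟩ := hf.exists_size_le
  obtain ⟨p, P, hp⟩ := hf
  obtain ⟨q, P', hq⟩ := hg
  refine ⟨seq p q, P + P'.comp Q, fun a r => ((hp a r).seq (hq (f a) r)).mono ?_⟩
  simpa using P'.monotone_eval_nat (hQ a)

theorem pair {f : γ → α} {g : γ → β} (hf : PolyTime f) (hg : PolyTime g) :
    PolyTime fun c => (f c, g c) := by
  obtain ⟨Q, hQ⟩ := hg.exists_size_le
  obtain ⟨p, P, hp⟩ := hf
  obtain ⟨q, P', hq⟩ := hg
  refine ⟨seq dup (seq q (seq swap (seq p (push .main true)))),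
    (12 * X + 4) + (P' + ((9 * (Q + X) + 6) + (P + 1))), fun c r => ?_⟩
  rw [word_pair, List.cons_append, List.append_assoc]
  refine ((runs_dup (toTree c) r).seq ((hq c _).seq ((runs_swap (toTree (g c)) (toTree c) r).seq
    ((hp c _).seq runs_push_main)))).mono ?_
  have := hQ c
  simp only [length_bits_toTree, eval_add, eval_mul, eval_X, eval_ofNat, eval_one]
  omega

theorem fst : PolyTime (Prod.fst : α × β → α) := by
  refine ⟨pop .main fun _ => seq swap drop, 9 * X + 6 + (6 * X + 2) + 1, fun c r => ?_⟩
  obtain ⟨a, b⟩ := c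
  rw [word_pair, List.cons_append, List.append_assoc]
  refine (runs_pop_main ((runs_swap (toTree a) (toTree b) r).seq
    (runs_drop (toTree b) (word a ++ r)))).mono ?_
  simp only [length_bits_toTree, eval_add, eval_mul, eval_X, eval_ofNat, eval_one, size_pair]
  omega

theorem snd : PolyTime (Prod.snd : α × β → β) := by
  refine ⟨pop .main fun _ => drop, 6 * X + 2 + 1, fun c r => ?_⟩
  obtain ⟨a, b⟩ := c
  rw [word_pair, List.cons_append, List.append_assoc]
  refine (runs_pop_main (runs_drop (toTree a) (word b ++ r))).mono ?_
  simp only [length_bits_toTree, eval_add, eval_mul, eval_X, eval_ofNat, eval_one, size_pair]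
  omega

theorem cons {f : γ → α} {l : γ → List α} (hf : PolyTime f) (hl : PolyTime l) :
    PolyTime fun c => f c :: l c :=
  (of_word_eq (f := fun p : α × List α => p.1 :: p.2) fun _ => rfl).comp (hf.pair hl)

theorem ite {b : γ → Bool} {f g : γ → α} (hb : PolyTime b) (hf : PolyTime f) (hg : PolyTime g) :
    PolyTime fun c => if b c then f c else g c := by
  obtain ⟨p, P, hp⟩ := hf
  obtain ⟨q, P', hq⟩ := hg
  suffices h : PolyTime fun p : Bool × γ => if p.1 then f p.2 else g p.2 from
    h.comp (hb.pair id)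
  refine ⟨pop .main fun _ => pop .main fun
      | some true => pop .main fun _ => pop .main fun _ => p
      | _ => q, P + P' + 4, fun c r => ?_⟩
  obtain ⟨b, c⟩ := c
  have hP := P.monotone_eval_nat (show size c ≤ size (b, c) by simp; omega)
  have hP' := P'.monotone_eval_nat (show size c ≤ size (b, c) by simp; omega)
  cases b
  · refine (runs_pop_main (runs_pop_main (hq c r))).mono ?_
    simp only [eval_add, eval_ofNat] at hP' ⊢
    omega
  · refine (runs_pop_main (runs_pop_main (runs_pop_main (runs_pop_main (hp c r))))).mono ?_
    simp only [eval_add, eval_ofNat] at hP ⊢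
    omega

/-- Case distinction on whether a list is empty. -/
theorem listCases {l : γ → List α} {f : γ → β} {g : γ → α → List α → β} (hl : PolyTime l)
    (hf : PolyTime f) (hg : PolyTime fun p : γ × α × List α => g p.1 p.2.1 p.2.2) :
    PolyTime fun c => match l c with
      | [] => f c
      | x :: t => g c x t := by
  obtain ⟨p, P, hp⟩ := hf
  obtain ⟨q, P', hq⟩ := hg
  suffices h : PolyTime fun p : List α × γ => match p.1 with
      | [] => f p.2
      | x :: t => g p.2 x t from h.comp (hl.pair id)
  refine ⟨pop .main fun _ => pop .main fun
      | some true => seq (push .main true) (seq swap (seq (push .main true) q))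
      | _ => p, P + P' + (9 * X + 10), fun c r => ?_⟩
  obtain ⟨l, c⟩ := c
  have hP := P.monotone_eval_nat (show size c ≤ size (l, c) by simp; omega)
  have hP' := P'.monotone_eval_nat (show size l + size c + 1 ≤ size (l, c) by simp)
  cases l with
  | nil =>
    refine (runs_pop_main (runs_pop_main (hp c r))).mono ?_
    simp only [eval_add, eval_ofNat, eval_mul, eval_X] at hP ⊢
    omega
  | cons x t =>
    have h₁ := hq (c, x, t) r
    rw [word_pair, List.cons_append, List.append_assoc] at h₁
    have h₂ := runs_push_main.seq ((runs_swap (toTree (x, t)) (toTree c) r).seq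
      (runs_push_main.seq h₁))
    rw [word_pair, List.cons_append, List.append_assoc, word_cons, List.cons_append]
    refine (runs_pop_main (runs_pop_main h₂)).mono ?_
    have e : P'.eval (size (c, x, t)) ≤ P'.eval (size (x :: t, c)) :=
      P'.monotone_eval_nat (by simp; omega)
    simp only [eval_add, eval_ofNat, eval_mul, eval_X, size_pair, size_cons] at e ⊢
    have : (toTree (x, t)).bits.length = size x + size t + 1 := size_pair x t
    have : (toTree c).bits.length = size c := rfl
    omega

end PolyTime

namespace PolyTime

open TreeCode StackProg WorkProg Polynomial

variable {α β γ σ : Type} [TreeCode α] [TreeCode β] [TreeCode γ] [TreeCode σ]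

theorem congr {f g : α → β} (hf : PolyTime f) (h : ∀ a, f a = g a) : PolyTime g :=
  funext h ▸ hf

/-- A loop that folds `F` over the list on top of the main stack, with the tree below it as the
current state. -/
theorem runs_foldLoop {F : σ → α → σ} {p : WorkProg} {P : ℕ[X]} {r : List Bool}
    (hp : ∀ x t s, Runs p (onMain (word (x :: t, s) ++ r)) (onMain (word (t, F s x) ++ r))
      (P.eval (size (x :: t, s)))) {N : ℕ} (l : List α) (s : σ)
    (hN : ∀ l₁ l₂, l = l₁ ++ l₂ → size l₂ + size (l₁.foldl F s) ≤ N) :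
    Runs (loop .main (fun o => o == some true)
        (seq (push .main true) (seq p (pop .main fun _ => skip))))
      (onMain (word l ++ (word s ++ r))) (onMain (false :: (word (l.foldl F s) ++ r)))
      (l.length * (P.eval (N + 1) + 4) + 1) := by
  induction l generalizing s with
  | nil => exact (Runs.loop_false rfl).mono (by simp)
  | cons x t ih =>
    have h₁ := hp x t s
    rw [word_pair, word_pair, List.cons_append, List.cons_append, List.append_assoc,
      List.append_assoc] at h₁
    refine (Runs.loop_true rfl (runs_push_main.seq (h₁.seq (runs_pop_main .skip)))
      (ih (F s x) fun l₁ l₂ e => ?_)).mono ?_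
    · exact hN (x :: l₁) l₂ (by rw [e]; rfl)
    · have : P.eval (size (x :: t, s)) ≤ P.eval (N + 1) := P.monotone_eval_nat (by
        rw [size_pair]
        exact Nat.succ_le_succ (hN [] (x :: t) rfl))
      rw [List.length_cons, Nat.succ_mul]
      omega

/-- A fold is computable in polynomial time if the intermediate states have polynomial size. -/
theorem foldl_of_size_le {l : γ → List α} {init : γ → σ} {f : γ → σ → α → σ} (hl : PolyTime l)
    (hi : PolyTime init) (hf : PolyTime fun p : (γ × σ) × α => f p.1.1 p.1.2 p.2)
    (hs : ∃ Q : ℕ[X], ∀ c l₁, l₁ <+: l c → size (l₁.foldl (f c) (init c)) ≤ Q.eval (size c)) :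
    PolyTime fun c => (l c).foldl (f c) (init c) := by
  let F : γ × σ → α → γ × σ := fun s x => (s.1, f s.1 s.2 x)
  have hF (c : γ) (l : List α) (s : σ) : l.foldl F (c, s) = (c, l.foldl (f c) s) := by
    induction l generalizing s with
    | nil => rfl
    | cons x l ih => exact ih _
  have hB : PolyTime fun p : List α × γ × σ => match p.1 with
      | [] => p
      | x :: t => (t, F p.2 x) := by
    refine listCases (g := fun p x t => (t, F p.2 x)) fst id ?_
    have hp : PolyTime fun q : (List α × γ × σ) × α × List α => q.1.2 := snd.comp fst
    exact (snd.comp snd).pair ((fst.comp hp).pair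
      (hf.comp (hp.pair (fst.comp snd))))
  obtain ⟨p, P, hp⟩ := hB
  obtain ⟨q, P', hq⟩ := hl.pair (id.pair hi)
  obtain ⟨Q, hQ⟩ := hs
  obtain ⟨R, hR⟩ := hl.exists_size_le
  suffices h : PolyTime fun c => (c, (l c).foldl (f c) (init c)) from snd.comp h
  let N : ℕ[X] := R + (X + Q + 1)
  refine ⟨seq q (seq (pop .main fun _ => skip) (seq (loop .main (fun o => o == some true)
      (seq (push .main true) (seq p (pop .main fun _ => skip)))) (pop .main fun _ => skip))),
    P' + (R * (P.comp (N + 1) + 4) + 5), fun c r => ?_⟩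
  have h₁ := hq c r
  rw [word_pair, List.cons_append, List.append_assoc] at h₁
  have h₂ := runs_foldLoop (F := F) (N := N.eval (size c)) (P := P) (r := r)
    (fun x t s => hp (x :: t, s) r) (l c) (c, init c) fun l₁ l₂ e => by
      have e₁ := hQ c l₁ ⟨l₂, e.symm⟩
      have e₂ := hR c
      have e₃ := size_append l₁ l₂
      have e₄ := size_pos l₁
      rw [← e] at e₃
      rw [hF, size_pair]
      simp only [N, eval_add, eval_X, eval_one]
      omega
  rw [hF] at h₂
  refine (h₁.seq ((runs_pop_main .skip).seq (h₂.seq (runs_pop_main .skip)))).mono ?_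
  have e₁ : (l c).length ≤ R.eval (size c) := (length_lt_size _).le.trans (hR c)
  have e₂ := Nat.mul_le_mul_right (eval (eval (size c) N + 1) P + 4) e₁
  simp only [eval_add, eval_mul, eval_comp, eval_ofNat, eval_one]
  omega

/-- A fold is computable in polynomial time if every step makes the state longer by an amount that
is polynomial in the length of the input. -/
theorem foldl {l : γ → List α} {init : γ → σ} {f : γ → σ → α → σ} (hl : PolyTime l)
    (hi : PolyTime init) (hf : PolyTime fun p : (γ × σ) × α => f p.1.1 p.1.2 p.2)
    (hs : ∃ Q : ℕ[X], ∀ c s x, x ∈ l c → size (f c s x) ≤ size s + Q.eval (size c)) :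
    PolyTime fun c => (l c).foldl (f c) (init c) := by
  obtain ⟨Q, hQ⟩ := hs
  obtain ⟨R, hR⟩ := hl.exists_size_le
  obtain ⟨R', hR'⟩ := hi.exists_size_le
  refine foldl_of_size_le hl hi hf ⟨R' + R * Q, fun c l₁ hl₁ => ?_⟩
  have key (l₁ : List α) (s : σ) (h : ∀ x ∈ l₁, x ∈ l c) :
      size (l₁.foldl (f c) s) ≤ size s + l₁.length * Q.eval (size c) := by
    induction l₁ generalizing s with
    | nil => simp
    | cons x t ih =>
      have hx := h x (by simp)
      have := ih (f c s x) fun y hy => h y (by simp [hy])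
      have := hQ c s x hx
      rw [List.foldl_cons, List.length_cons, Nat.succ_mul]
      omega
  have h₁ := key l₁ (init c) fun x hx => hl₁.subset hx
  have h₂ : l₁.length * Q.eval (size c) ≤ R.eval (size c) * Q.eval (size c) :=
    Nat.mul_le_mul_right _ (hl₁.length_le.trans ((length_lt_size _).le.trans (hR c)))
  have h₃ := hR' c
  simp only [eval_add, eval_mul]
  omega

/-- The values of a function of a list entry and a context have polynomial size. -/
theorem exists_size_le_of_mem {l : γ → List α} {f : γ → α → β} (hl : PolyTime l)
    (hf : PolyTime fun p : γ × α => f p.1 p.2) :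
    ∃ Q : ℕ[X], ∀ c, ∀ x ∈ l c, size (f c x) ≤ Q.eval (size c) := by
  obtain ⟨R, hR⟩ := hl.exists_size_le
  obtain ⟨Q, hQ⟩ := hf.exists_size_le
  refine ⟨Q.comp (X + R + 1), fun c x hx => (hQ (c, x)).trans ?_⟩
  simp only [eval_comp, eval_add, eval_X, eval_one]
  refine Q.monotone_eval_nat ?_
  have := hR c
  have := size_le_of_mem hx
  rw [size_pair]
  omega

theorem reverse {l : γ → List α} (hl : PolyTime l) : PolyTime fun c => (l c).reverse := by
  refine (foldl (f := fun _ s x => x :: s) hl (const []) (cons snd (snd.comp fst)) ?_).congr fun c => by simp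
  obtain ⟨Q, hQ⟩ := exists_size_le_of_mem (f := fun _ x => x) hl snd
  refine ⟨Q + 1, fun c s x hx => ?_⟩
  have := hQ c x hx
  simp only [size_cons, eval_add, eval_one]
  omega

theorem append {l l' : γ → List α} (hl : PolyTime l) (hl' : PolyTime l') :
    PolyTime fun c => l c ++ l' c := by
  refine (foldl (f := fun _ s x => x :: s) hl.reverse hl' (cons snd (snd.comp fst)) ?_).congr fun c => by simp
  obtain ⟨Q, hQ⟩ := exists_size_le_of_mem (f := fun _ x => x) hl.reverse snd
  refine ⟨Q + 1, fun c s x hx => ?_⟩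
  have := hQ c x hx
  simp only [size_cons, eval_add, eval_one]
  omega

theorem flatMap {l : γ → List α} {f : γ → α → List β} (hl : PolyTime l)
    (hf : PolyTime fun p : γ × α => f p.1 p.2) : PolyTime fun c => (l c).flatMap (f c) := by
  refine (foldl (f := fun c s x => s ++ f c x) hl (const [])
    (append (snd.comp fst) (hf.comp ((fst.comp fst).pair snd))) ?_).congr fun c => ?_
  · obtain ⟨Q, hQ⟩ := exists_size_le_of_mem hl hf
    refine ⟨Q, fun c s x hx => ?_⟩
    have := hQ c x hx
    have := size_append s (f c x)
    omega
  · have key (m : List α) (s : List β) :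
        m.foldl (fun s x => s ++ f c x) s = s ++ m.flatMap (f c) := by
      induction m generalizing s with
      | nil => simp
      | cons x t ih => rw [List.foldl_cons, ih, List.flatMap_cons, List.append_assoc]
    exact key _ _

theorem map {l : γ → List α} {f : γ → α → β} (hl : PolyTime l)
    (hf : PolyTime fun p : γ × α => f p.1 p.2) : PolyTime fun c => (l c).map (f c) :=
  (flatMap (f := fun c x => [f c x]) hl (cons hf (const []))).congr fun c => by
    induction l c <;> simp_all

theorem filter {l : γ → List α} {f : γ → α → Bool} (hl : PolyTime l)
    (hf : PolyTime fun p : γ × α => f p.1 p.2) : PolyTime fun c => (l c).filter (f c) :=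
  (flatMap (f := fun c x => if f c x then [x] else []) hl
    (ite hf (cons snd (const [])) (const []))).congr fun c => by
      induction l c with
      | nil => rfl
      | cons x t ih => rw [List.flatMap_cons, ih, List.filter_cons]; split <;> rfl

theorem not {b : γ → Bool} (hb : PolyTime b) : PolyTime fun c => !b c :=
  (ite hb (const false) (const true)).congr fun c => by cases b c <;> rfl

theorem and {b b' : γ → Bool} (hb : PolyTime b) (hb' : PolyTime b') :
    PolyTime fun c => b c && b' c :=
  (ite hb hb' (const false)).congr fun c => by cases b c <;> rfl

theorem isEmpty {l : γ → List α} (hl : PolyTime l) : PolyTime fun c => (l c).isEmpty :=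
  (listCases (g := fun _ _ _ => false) hl (const true) (const false)).congr fun c => by
    cases l c <;> rfl

theorem tail {l : γ → List α} (hl : PolyTime l) : PolyTime fun c => (l c).tail :=
  (listCases (g := fun _ _ t => t) hl (const []) (snd.comp snd)).congr fun c => by
    cases l c <;> rfl

theorem all {l : γ → List α} {f : γ → α → Bool} (hl : PolyTime l)
    (hf : PolyTime fun p : γ × α => f p.1 p.2) : PolyTime fun c => (l c).all (f c) :=
  (filter (f := fun c x => !f c x) hl hf.not).isEmpty.congr fun c => by
    induction l c with
    | nil => rfl
    | cons x t ih => rw [List.filter_cons, List.all_cons]; cases h : f c x <;> simp [ih]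

theorem any {l : γ → List α} {f : γ → α → Bool} (hl : PolyTime l)
    (hf : PolyTime fun p : γ × α => f p.1 p.2) : PolyTime fun c => (l c).any (f c) :=
  (filter hl hf).isEmpty.not.congr fun c => by
    induction l c with
    | nil => rfl
    | cons x t ih => rw [List.filter_cons, List.any_cons]; cases h : f c x <;> simp [ih]

/-- A case distinction on a bit. -/
theorem boolCases {b : γ → Bool} {f : Bool → γ → β} (hb : PolyTime b)
    (hf : ∀ x, PolyTime (f x)) : PolyTime fun c => f (b c) c :=
  (ite hb (hf true) (hf false)).congr fun c => by cases b c <;> rfl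

theorem foldr {l : γ → List α} {init : γ → σ} {f : γ → α → σ → σ} (hl : PolyTime l)
    (hi : PolyTime init) (hf : PolyTime fun p : (γ × σ) × α => f p.1.1 p.2 p.1.2)
    (hs : ∃ Q : ℕ[X], ∀ c s x, x ∈ l c → size (f c x s) ≤ size s + Q.eval (size c)) :
    PolyTime fun c => (l c).foldr (f c) (init c) := by
  obtain ⟨Q, hQ⟩ := hs
  exact (foldl (f := fun c s x => f c x s) hl.reverse hi hf
    ⟨Q, fun c s x hx => hQ c s x (List.mem_reverse.1 hx)⟩).congr
    fun c => List.foldl_reverse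

theorem listEq [DecidableEq α] (h : PolyTime fun p : α × α => decide (p.1 = p.2))
    {l l' : γ → List α} (hl : PolyTime l) (hl' : PolyTime l') :
    PolyTime fun c => decide (l c = l' c) := by
  let f : List α × Bool → α → List α × Bool := fun s x => match s.1 with
    | [] => ([], false)
    | y :: t => (t, s.2 && decide (x = y))
  have hf : PolyTime fun p : (γ × List α × Bool) × α => f p.1.2 p.2 := by
    refine listCases (l := fun p : (γ × List α × Bool) × α => p.1.2.1)
      (g := fun p y t => (t, p.1.2.2 && decide (p.2 = y))) (fst.comp (snd.comp fst))
      (const ([], false)) ((snd.comp snd).pair (and (snd.comp (snd.comp (fst.comp fst))) ?_))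
    exact h.comp ((snd.comp fst).pair (fst.comp snd))
  have key (l l' : List α) (b : Bool) :
      (((l.foldl f (l', b)).1.isEmpty && (l.foldl f (l', b)).2) = true) ↔ l = l' ∧ b = true := by
    induction l generalizing l' b with
    | nil => cases l' <;> simp
    | cons x l ih =>
      rw [List.foldl_cons]
      cases l' with
      | nil =>
        rw [show f ([], b) x = ([], false) from rfl, ih]
        simp
      | cons y t =>
        rw [show f (y :: t, b) x = (t, b && decide (x = y)) from rfl, ih]
        simp
        tauto
  have hF := foldl (f := fun _ => f) hl (hl'.pair (const true)) hf
    ⟨3, fun c s x _ => by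
      obtain ⟨_ | ⟨y, t⟩, b⟩ := s
      · have := size_bool_le false
        simp only [f, size_pair, eval_ofNat]
        omega
      · have := size_bool_le (b && decide (x = y))
        simp only [f, size_pair, size_cons, eval_ofNat]
        omega⟩
  refine (and (fst.comp hF).isEmpty (snd.comp hF)).congr fun c => ?_
  rw [Bool.eq_iff_iff, key]
  simp

theorem listMem [DecidableEq α] (h : PolyTime fun p : α × α => decide (p.1 = p.2))
    {x : γ → α} {l : γ → List α} (hx : PolyTime x) (hl : PolyTime l) :
    PolyTime fun c => decide (x c ∈ l c) :=
  (any (f := fun c y => decide (x c = y)) hl (h.comp ((hx.comp fst).pair snd))).congr fun c => by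
    rw [Bool.eq_iff_iff]; simp

theorem headD {l : γ → List α} {x : γ → α} (hl : PolyTime l) (hx : PolyTime x) :
    PolyTime fun c => (l c).headD (x c) :=
  (listCases (g := fun _ y _ => y) hl hx (fst.comp snd)).congr fun c => by cases l c <;> rfl

theorem zip {l : γ → List α} {l' : γ → List β} (hl : PolyTime l) (hl' : PolyTime l') :
    PolyTime fun c => (l c).zip (l' c) := by
  let f : List β × List (α × β) → α → List β × List (α × β) := fun s x => match s.1 with
    | [] => ([], s.2)
    | y :: t => (t, (x, y) :: s.2)
  have hf : PolyTime fun p : (γ × List β × List (α × β)) × α => f p.1.2 p.2 := by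
    have h : PolyTime fun p : (γ × List β × List (α × β)) × α => p.1.2.2 :=
      snd.comp (snd.comp fst)
    exact listCases (l := fun p : (γ × List β × List (α × β)) × α => p.1.2.1)
      (g := fun p y t => (t, (p.2, y) :: p.1.2.2)) (fst.comp (snd.comp fst))
      ((const []).pair h) ((snd.comp snd).pair (cons ((snd.comp fst).pair (fst.comp snd))
        (h.comp fst)))
  have key (l : List α) (s : List β × List (α × β)) :
      (l.foldl f s).2.reverse = s.2.reverse ++ l.zip s.1 := by
    induction l generalizing s with
    | nil => simp
    | cons x l ih =>
      obtain ⟨_ | ⟨y, t⟩, s⟩ := s <;> rw [List.foldl_cons, ih] <;> simp [f]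
  obtain ⟨Q, hQ⟩ := exists_size_le_of_mem (f := fun _ x => x) hl snd
  have hF := foldl (f := fun _ => f) hl (hl'.pair (const [])) hf
    ⟨Q + 1, fun c s x hx => by
      have := hQ c x hx
      obtain ⟨_ | ⟨y, t⟩, s⟩ := s <;>
      · simp only [f, size_pair, size_cons, eval_add, eval_one]
        omega⟩
  exact (snd.comp hF).reverse.congr fun c => by rw [key]; rfl

theorem lengthEq {l : γ → List α} {l' : γ → List β} (hl : PolyTime l) (hl' : PolyTime l') :
    PolyTime fun c => decide ((l c).length = (l' c).length) := by
  refine (listEq ((const true).congr fun p : Unit × Unit => by simp)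
    (map (f := fun _ _ => ()) hl (const ())) (map (f := fun _ _ => ()) hl' (const ()))).congr
    fun c => ?_
  simp [List.map_const']

theorem size_tails_le (l : List α) : size l.tails ≤ (l.length + 1) * (size l + 1) + 1 := by
  induction l with
  | nil => simp [List.tails]
  | cons x l ih =>
    have : (l.length + 1) * (size l + 1) ≤ (l.length + 1) * (size (x :: l) + 1) := by
      gcongr; simp; omega
    rw [List.tails_cons, size_cons, List.length_cons, Nat.succ_mul (l.length + 1)]
    omega

theorem tails {l : γ → List α} (hl : PolyTime l) : PolyTime fun c => (l c).tails := by
  let f : List (List α) → α → List (List α) := fun s x => match s with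
    | [] => []
    | t :: ts => (x :: t) :: t :: ts
  have hf : PolyTime fun p : (γ × List (List α)) × α => f p.1.2 p.2 := by
    refine (listCases (l := fun p : (γ × List (List α)) × α => p.1.2) (f := fun _ => [])
      (g := fun p t ts => (p.2 :: t) :: t :: ts) (snd.comp fst) (const []) ?_).congr fun p => by
        obtain ⟨⟨_, _ | _⟩, _⟩ := p <;> rfl
    have h := fst.comp (snd (α := (γ × List (List α)) × α) (β := List α × List (List α)))
    exact cons (cons (snd.comp fst) h) (cons h (snd.comp snd))
  have key (l : List α) : l.foldl f [[]] = l.reverse.tails := by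
    rw [← List.foldr_reverse]
    generalize l.reverse = l
    induction l with
    | nil => rfl
    | cons x l ih =>
      rw [List.foldr_cons, ih]
      cases l <;> rfl
  refine (foldl_of_size_le (f := fun _ => f) hl.reverse (const [[]]) hf ?_).congr fun c => by
    rw [key, List.reverse_reverse]
  obtain ⟨Q, hQ⟩ := hl.exists_size_le
  refine ⟨(Q + 1) * (Q + 1) + 1, fun c l₁ hl₁ => ?_⟩
  obtain ⟨l₂, h₂⟩ := List.reverse_prefix.1 (by rwa [List.reverse_reverse] :
    l₁.reverse.reverse <+: (l c).reverse)
  have h₃ : size l₁.reverse ≤ Q.eval (size c) := by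
    have := size_append l₂ l₁.reverse
    have := size_pos l₂
    have := hQ c
    rw [← h₂] at this
    omega
  have h₄ := length_lt_size l₁.reverse
  rw [key]
  refine (size_tails_le _).trans ?_
  simp only [eval_add, eval_mul, eval_one]
  gcongr
  omega

end PolyTime

/-! ### Input symbols as data -/

/-- A code of input symbols by four bits. -/
def InputSym.toBits : InputSym → Bool × Bool × Bool × Bool
  | bit b => (false, false, false, b)
  | sign b => (false, false, true, b)
  | star => (false, true, false, false)
  | issue => (false, true, false, true)
  | clause => (false, true, true, false)
  | ballot => (false, true, true, true)
  | sep => (true, false, false, false)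

/-- The inverse of `InputSym.toBits`, with a junk value on the codes that are not in use. -/
def InputSym.ofBits : Bool × Bool × Bool × Bool → InputSym
  | (false, false, false, b) => bit b
  | (false, false, true, b) => sign b
  | (false, true, false, false) => star
  | (false, true, false, true) => issue
  | (false, true, true, false) => clause
  | (false, true, true, true) => ballot
  | _ => sep

theorem InputSym.ofBits_toBits (s : InputSym) : ofBits s.toBits = s := by
  rcases s with (_ | _) | _ | (_ | _) | _ | _ | _ | _ <;> rfl

noncomputable instance : Fintype InputSym :=
  Fintype.ofInjective InputSym.toBits (Function.LeftInverse.injective InputSym.ofBits_toBits)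

instance : TreeCode InputSym := ⟨fun s => TreeCode.toTree s.toBits⟩

namespace PolyTime

open TreeCode

variable {β γ : Type} [TreeCode β] [TreeCode γ]

/-- A case distinction on an input symbol. -/
theorem inputSymCases {s : γ → InputSym} {f : InputSym → γ → β} (hs : PolyTime s)
    (hf : ∀ x, PolyTime (f x)) : PolyTime fun c => f (s c) c := by
  have h : PolyTime fun c => (s c).toBits :=
    (of_word_eq (f := InputSym.toBits) fun _ => rfl).comp hs
  refine (boolCases (f := fun b₁ c => f (.ofBits (b₁, (s c).toBits.2)) c) (fst.comp h) fun b₁ =>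
    boolCases (f := fun b₂ c => f (.ofBits (b₁, b₂, (s c).toBits.2.2)) c) (fst.comp (snd.comp h))
    fun b₂ => boolCases (f := fun b₃ c => f (.ofBits (b₁, b₂, b₃, (s c).toBits.2.2.2)) c)
    (fst.comp (snd.comp (snd.comp h))) fun b₃ =>
    boolCases (f := fun b₄ c => f (.ofBits (b₁, b₂, b₃, b₄)) c) (snd.comp (snd.comp (snd.comp h)))
    fun b₄ => hf _).congr fun c => ?_
  exact congrArg (f · c) (InputSym.ofBits_toBits (s c))

theorem of_inputSym (f : InputSym → β) : PolyTime f :=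
  inputSymCases (f := fun x _ => f x) id fun x => const (f x)

theorem inputSymEq : PolyTime fun p : InputSym × InputSym => decide (p.1 = p.2) :=
  inputSymCases (f := fun x (p : InputSym × InputSym) => decide (x = p.2)) fst fun x =>
    (of_inputSym fun y => decide (x = y)).comp snd

end PolyTime

/-! ### The algorithm -/

namespace UnitPropagation

variable {α : Type} [DecidableEq α] (neg : α → α)

/-- The literals of the clause `c` that are not falsified by the set `A` of true literals. -/
def live (A c : List α) : List α := c.filter fun l => !decide (neg l ∈ A)

/-- Unit propagation with one clause: if at most one literal of `c` is not falsified by `A`, this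
literal has to be true. -/
def propagate (A c : List α) : List α :=
  if (live neg A c).tail.isEmpty then ((live neg A c).filter fun l => !decide (l ∈ A)) ++ A else A

/-- One round of unit propagation with all clauses of the formula `Γ`. -/
def round (Γ : List (List α)) (A : List α) : List α := Γ.foldl (propagate neg) A

/-- The closure of a set of literals under unit propagation. Every round that changes the set uses
up a clause, so that there are at most as many of them as there are clauses. -/
def closure (Γ : List (List α)) (A : List α) : List α := Γ.foldl (fun A _ => round neg Γ A) A

/-- No clause is falsified by `A`, and `A` contains no complementary pair. -/
def conflictFree (Γ : List (List α)) (A : List α) : Bool :=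
  (Γ.all fun c => !(live neg A c).isEmpty) && A.all fun l => !decide (neg l ∈ A)

/-- Add the literal `l` to `S`, unless unit propagation finds a conflict. -/
def accept (Γ : List (List α)) (S : List α) (l : α) : List α :=
  if conflictFree neg Γ (closure neg Γ (l :: S)) then l :: S else S

/-- The literals `tb` in the order of descending majority strength, where ties are broken by the
position in `tb`. A ballot is given by the list of the literals that it makes true. The thresholds
are the lengths of the suffixes of the list of ballots. -/
def ranked (tb : List α) (ballots : List (List α)) : List α :=
  ballots.tails.flatMap fun t =>
    tb.filter fun l => decide ((ballots.filter fun r => decide (l ∈ r)).length = t.length)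

/-- The literals that are set to true if the literals in `L` are processed one after the other. -/
def outcome (Γ : List (List α)) (L : List α) : List α := L.foldl (accept neg Γ) []

/-- Whether all literals in `target` are set to true if the literals in `L` are processed one after
the other. -/
def answer (Γ : List (List α)) (L target : List α) : Bool :=
  target.all fun l => decide (l ∈ outcome neg Γ L)

/-! ### The algorithm runs in polynomial time -/

open TreeCode PolyTime

variable {neg} {γ : Type} [TreeCode α] [TreeCode γ]

theorem polyTime_live (he : PolyTime fun p : α × α => decide (p.1 = p.2)) (hn : PolyTime neg)
    {A c : γ → List α} (hA : PolyTime A) (hc : PolyTime c) :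
    PolyTime fun x => live neg (A x) (c x) :=
  filter (f := fun x l => !decide (neg l ∈ A x)) hc
    (listMem he (hn.comp snd) (hA.comp fst)).not

theorem polyTime_propagate (he : PolyTime fun p : α × α => decide (p.1 = p.2))
    (hn : PolyTime neg) {A c : γ → List α} (hA : PolyTime A) (hc : PolyTime c) :
    PolyTime fun x => propagate neg (A x) (c x) :=
  have hl := polyTime_live he hn hA hc
  ite hl.tail.isEmpty (append (filter (f := fun x l => !decide (l ∈ A x)) hl
    (listMem he snd (hA.comp fst)).not) hA) hA

theorem size_propagate_le (A c : List α) : size (propagate neg A c) ≤ size A + size c := by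
  unfold propagate
  split
  · have := size_append ((live neg A c).filter fun l => !decide (l ∈ A)) A
    have := size_filter_le (live neg A c) fun l => !decide (l ∈ A)
    have : size (live neg A c) ≤ size c := size_filter_le _ _
    omega
  · omega

theorem size_round_le (Γ : List (List α)) (A : List α) :
    size (round neg Γ A) ≤ size A + size Γ := by
  unfold round
  induction Γ generalizing A with
  | nil => simp
  | cons c Γ ih =>
    have := ih (propagate neg A c)
    have := size_propagate_le (neg := neg) A c
    rw [List.foldl_cons, size_cons]
    omega

theorem polyTime_round (he : PolyTime fun p : α × α => decide (p.1 = p.2)) (hn : PolyTime neg)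
    {Γ : γ → List (List α)} {A : γ → List α} (hΓ : PolyTime Γ) (hA : PolyTime A) :
    PolyTime fun x => round neg (Γ x) (A x) := by
  obtain ⟨Q, hQ⟩ := exists_size_le_of_mem (f := fun _ c => c) hΓ snd
  exact foldl (f := fun _ => propagate neg) hΓ hA
    (polyTime_propagate he hn (snd.comp fst) snd) ⟨Q, fun x A c hc => (size_propagate_le A c).trans
      (Nat.add_le_add_left (hQ x c hc) _)⟩

theorem polyTime_closure (he : PolyTime fun p : α × α => decide (p.1 = p.2)) (hn : PolyTime neg)
    {Γ : γ → List (List α)} {A : γ → List α} (hΓ : PolyTime Γ) (hA : PolyTime A) :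
    PolyTime fun x => closure neg (Γ x) (A x) := by
  obtain ⟨Q, hQ⟩ := hΓ.exists_size_le
  exact foldl (f := fun x A _ => round neg (Γ x) A) hΓ hA
    (polyTime_round he hn (hΓ.comp (fst.comp fst)) (snd.comp fst)) ⟨Q, fun x A c hc =>
      (size_round_le (Γ x) A).trans (Nat.add_le_add_left (hQ x) _)⟩

theorem polyTime_conflictFree (he : PolyTime fun p : α × α => decide (p.1 = p.2))
    (hn : PolyTime neg) {Γ : γ → List (List α)} {A : γ → List α} (hΓ : PolyTime Γ)
    (hA : PolyTime A) : PolyTime fun x => conflictFree neg (Γ x) (A x) :=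
  and (all (f := fun x c => !(live neg (A x) c).isEmpty) hΓ
      (polyTime_live he hn (hA.comp fst) snd).isEmpty.not)
    (all (f := fun x l => !decide (neg l ∈ A x)) hA
      (listMem he (hn.comp snd) (hA.comp fst)).not)

theorem polyTime_accept (he : PolyTime fun p : α × α => decide (p.1 = p.2)) (hn : PolyTime neg)
    {Γ : γ → List (List α)} {S : γ → List α} {l : γ → α} (hΓ : PolyTime Γ) (hS : PolyTime S)
    (hl : PolyTime l) : PolyTime fun x => accept neg (Γ x) (S x) (l x) :=
  ite (polyTime_conflictFree he hn hΓ (polyTime_closure he hn hΓ (cons hl hS))) (cons hl hS) hS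

theorem polyTime_ranked (he : PolyTime fun p : α × α => decide (p.1 = p.2)) {tb : γ → List α}
    {ballots : γ → List (List α)} (ht : PolyTime tb) (hb : PolyTime ballots) :
    PolyTime fun x => ranked (tb x) (ballots x) :=
  have hr : PolyTime fun p : (γ × List (List α)) × α =>
      (ballots p.1.1).filter fun r => decide (p.2 ∈ r) :=
    filter (f := fun (p : (γ × List (List α)) × α) r => decide (p.2 ∈ r))
      (hb.comp (fst.comp fst)) (listMem he (snd.comp fst) snd)
  have hf : PolyTime fun p : γ × List (List α) => (tb p.1).filter fun l => decide
      (((ballots p.1).filter fun r => decide (l ∈ r)).length = p.2.length) :=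
    filter (f := fun (p : γ × List (List α)) l => decide
      (((ballots p.1).filter fun r => decide (l ∈ r)).length = p.2.length)) (ht.comp fst)
      (lengthEq hr (snd.comp fst))
  flatMap (f := fun x (t : List (List α)) => (tb x).filter fun l => decide
    (((ballots x).filter fun r => decide (l ∈ r)).length = t.length)) hb.tails hf

theorem polyTime_outcome (he : PolyTime fun p : α × α => decide (p.1 = p.2)) (hn : PolyTime neg)
    {Γ : γ → List (List α)} {L : γ → List α} (hΓ : PolyTime Γ) (hL : PolyTime L) :
    PolyTime fun x => outcome neg (Γ x) (L x) := by
  obtain ⟨Q, hQ⟩ := exists_size_le_of_mem (f := fun _ l => l) hL snd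
  refine foldl (f := fun x => accept neg (Γ x)) hL (const [])
    (polyTime_accept he hn (hΓ.comp (fst.comp fst)) (snd.comp fst) snd)
    ⟨Q + 1, fun x S l hl => ?_⟩
  have := hQ x l hl
  rw [accept, Polynomial.eval_add, Polynomial.eval_one]
  split
  · rw [size_cons]; omega
  · omega

theorem polyTime_answer (he : PolyTime fun p : α × α => decide (p.1 = p.2)) (hn : PolyTime neg)
    {Γ : γ → List (List α)} {L target : γ → List α} (hΓ : PolyTime Γ) (hL : PolyTime L)
    (ht : PolyTime target) : PolyTime fun x => answer neg (Γ x) (L x) (target x) :=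
  all (f := fun x l => decide (l ∈ outcome neg (Γ x) (L x))) ht
    (listMem he snd ((polyTime_outcome he hn hΓ hL).comp fst))

end UnitPropagation

/-! ### Unit propagation reaches a fixed point -/

namespace UnitPropagation

variable {α : Type} [DecidableEq α] {neg : α → α}

theorem live_subset_live {A A' : List α} (h : A ⊆ A') (c : List α) :
    live neg A' c ⊆ live neg A c := by
  intro l hl
  simp only [live, List.mem_filter, Bool.not_eq_true', decide_eq_false_iff_not] at hl ⊢
  exact ⟨hl.1, fun h' => hl.2 (h h')⟩

theorem subset_propagate (A c : List α) : A ⊆ propagate neg A c := by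
  unfold propagate
  split <;> simp

theorem subset_foldl_propagate (Γ : List (List α)) (A : List α) :
    A ⊆ Γ.foldl (propagate neg) A := by
  induction Γ generalizing A with
  | nil => simp
  | cons c Γ ih => exact List.Subset.trans (subset_propagate A c) (ih _)

theorem subset_closure (Γ : List (List α)) (A : List α) : A ⊆ closure neg Γ A := by
  have key (L : List (List α)) (A : List α) : A ⊆ L.foldl (fun A _ => round neg Γ A) A := by
    induction L generalizing A with
    | nil => simp
    | cons c L ih => exact List.Subset.trans (subset_foldl_propagate Γ A) (ih _)
  exact key Γ A

/-- The clause `c` allows no further propagation. -/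
def Stable (neg : α → α) (A c : List α) : Prop :=
  (live neg A c).tail = [] → live neg A c ⊆ A

theorem propagate_eq_or (A c : List α) :
    (propagate neg A c = A ∧ Stable neg A c) ∨
      (¬ live neg A c ⊆ A ∧ live neg (propagate neg A c) c ⊆ propagate neg A c) := by
  by_cases h : (live neg A c).tail = []
  · have e : propagate neg A c = ((live neg A c).filter fun l => !decide (l ∈ A)) ++ A := by
      simp [propagate, h]
    by_cases hs : live neg A c ⊆ A
    · refine .inl ⟨?_, fun _ => hs⟩
      rw [e, List.filter_eq_nil_iff.2 fun l hl => by simpa using hs hl, List.nil_append]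
    · refine .inr ⟨hs, fun l hl => ?_⟩
      have := live_subset_live (subset_propagate A c) c hl
      rw [e]
      by_cases l ∈ A <;> simp_all
  · exact .inl ⟨by simp [propagate, h], fun h' => absurd h' h⟩

/-- A clause all of whose live literals are true keeps this property. -/
theorem live_subset_of_subset {A A' c : List α} (h : A ⊆ A') (hc : live neg A c ⊆ A) :
    live neg A' c ⊆ A' :=
  fun _ hl => h (hc (live_subset_live h c hl))

theorem foldl_propagate_eq_or (Γ : List (List α)) (A : List α) :
    (Γ.foldl (propagate neg) A = A ∧ ∀ c ∈ Γ, Stable neg A c) ∨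
      ∃ c ∈ Γ, ¬ live neg A c ⊆ A ∧
        live neg (Γ.foldl (propagate neg) A) c ⊆ Γ.foldl (propagate neg) A := by
  induction Γ generalizing A with
  | nil => simp
  | cons c Γ ih =>
    rw [List.foldl_cons]
    rcases propagate_eq_or (neg := neg) A c with ⟨h, hs⟩ | ⟨h, h'⟩
    · rw [h]
      rcases ih A with ⟨h₁, h₂⟩ | ⟨d, hd, h₁⟩
      · exact .inl ⟨h₁, by simpa using ⟨hs, h₂⟩⟩
      · exact .inr ⟨d, by simp [hd], h₁⟩
    · exact .inr ⟨c, by simp, h, live_subset_of_subset (subset_foldl_propagate Γ _) h'⟩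

/-- The number of clauses that may still be used up by unit propagation. -/
def pending (neg : α → α) (Γ : List (List α)) (A : List α) : ℕ :=
  Γ.countP fun c => !decide (live neg A c ⊆ A)

theorem round_eq_or (Γ : List (List α)) (A : List α) :
    (round neg Γ A = A ∧ ∀ c ∈ Γ, Stable neg A c) ∨
      pending neg Γ (round neg Γ A) < pending neg Γ A := by
  refine (foldl_propagate_eq_or Γ A).imp_right fun ⟨c, hc, h₁, h₂⟩ => ?_
  have hs : A ⊆ round neg Γ A := subset_foldl_propagate Γ A
  obtain ⟨Γ₁, Γ₂, e⟩ := List.append_of_mem hc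
  have mono (Γ' : List (List α)) : pending neg Γ' (round neg Γ A) ≤ pending neg Γ' A :=
    List.countP_mono_left fun d _ hd => by
      simp only [Bool.not_eq_true', decide_eq_false_iff_not] at hd ⊢
      exact fun h => hd (live_subset_of_subset hs h)
  have m₁ := mono Γ₁
  have m₂ := mono Γ₂
  have key (B : List α) : pending neg Γ B = pending neg Γ₁ B +
      (pending neg Γ₂ B + if live neg B c ⊆ B then 0 else 1) := by
    rw [e]
    simp [pending, List.countP_append, List.countP_cons]
  have h₂' : live neg (round neg Γ A) c ⊆ round neg Γ A := h₂
  rw [key, key A, if_neg h₁, if_pos h₂']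
  omega

theorem stable_closure (Γ : List (List α)) (A : List α) :
    ∀ c ∈ Γ, Stable neg (closure neg Γ A) c := by
  have key (L : List (List α)) (A : List α) (h : pending neg Γ A ≤ L.length) :
      ∀ c ∈ Γ, Stable neg (L.foldl (fun A _ => round neg Γ A) A) c := by
    induction L generalizing A with
    | nil =>
      intro c hc _
      have := List.countP_eq_zero.1 (Nat.le_zero.1 h) c hc
      simpa using this
    | cons d L ih =>
      rw [List.foldl_cons]
      rcases round_eq_or (neg := neg) Γ A with ⟨h₁, h₂⟩ | h₁
      · have fix : ∀ L : List (List α), L.foldl (fun A _ => round neg Γ A) A = A := by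
          intro L
          induction L with
          | nil => rfl
          | cons d L ih => rwa [List.foldl_cons, h₁]
        rwa [h₁, fix]
      · exact ih _ (by rw [List.length_cons] at h; omega)
  exact key Γ A List.countP_le_length

/-- Unit propagation only derives literals that are true under every valuation `v` that makes the
formula and the given literals true. -/
theorem closure_sound {v : α → Prop} (hv : ∀ l, v (neg l) ↔ ¬ v l) {Γ : List (List α)}
    (hΓ : ∀ c ∈ Γ, ∃ l ∈ c, v l) {A : List α} (hA : ∀ l ∈ A, v l) :
    ∀ l ∈ closure neg Γ A, v l := by
  have h₁ (c : List α) (hc : c ∈ Γ) (A : List α) (hA : ∀ l ∈ A, v l) :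
      ∀ l ∈ propagate neg A c, v l := by
    intro l hl
    unfold propagate at hl
    split at hl
    next ht =>
      obtain ⟨k, hk, hvk⟩ := hΓ c hc
      have hk : k ∈ live neg A c := by
        simp only [live, List.mem_filter, Bool.not_eq_true', decide_eq_false_iff_not]
        exact ⟨hk, fun h => (hv k).1 (hA _ h) hvk⟩
      rcases List.mem_append.1 hl with hl | hl
      · have hl := (List.mem_filter.1 hl).1
        obtain ⟨x, hx⟩ : ∃ x, live neg A c = [x] := by
          match live neg A c, ht, hk with
          | [x], _, _ => exact ⟨x, rfl⟩
        rw [hx, List.mem_singleton] at hl hk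
        rwa [hl, ← hk]
      · exact hA l hl
    next => exact hA l hl
  have h₂ (L : List (List α)) (hL : L ⊆ Γ) (A : List α) (hA : ∀ l ∈ A, v l) :
      ∀ l ∈ L.foldl (propagate neg) A, v l := by
    induction L generalizing A with
    | nil => exact hA
    | cons c L ih =>
      rw [List.cons_subset] at hL
      exact ih hL.2 _ (h₁ c hL.1 A hA)
  have h₃ (L : List (List α)) (A : List α) (hA : ∀ l ∈ A, v l) :
      ∀ l ∈ L.foldl (fun A _ => round neg Γ A) A, v l := by
    induction L generalizing A with
    | nil => exact hA
    | cons c L ih => exact ih _ (h₂ Γ (List.Subset.refl Γ) A hA)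
  exact h₃ Γ A hA

end UnitPropagation

/-! ### Unit propagation decides consistency for Krom and Horn formulas -/

open UnitPropagation

/-- The complementary literal. -/
def Literal.neg (l : Literal) : Literal := ⟨l.var, !l.sign⟩

/-- If unit propagation closes `A` without a conflict, the formula is satisfiable by an assignment
that makes `A` true, and that agrees with `τ₀` on the other variables. Here `τ₀` has to take care of
the clauses with at least two live literals. -/
theorem exists_holds_of_conflictFree {Γ : CNF} {A : List Literal}
    (hs : ∀ c ∈ Γ.map Clause.lits, Stable Literal.neg A c)
    (hA : conflictFree Literal.neg (Γ.map Clause.lits) A = true) (τ₀ : ℕ → Bool)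
    (h₀ : ∀ c ∈ Γ, 2 ≤ (live Literal.neg A c.lits).length →
      ∃ l ∈ live Literal.neg A c.lits, τ₀ l.var = l.sign) :
    ∃ τ, CNF.Holds Γ τ ∧ ∀ l ∈ A, τ l.var = l.sign := by
  simp only [conflictFree, Bool.and_eq_true, List.all_eq_true, Bool.not_eq_true',
    decide_eq_false_iff_not, List.isEmpty_eq_false_iff] at hA
  let τ : ℕ → Bool := fun x =>
    if ⟨x, true⟩ ∈ A then true else if ⟨x, false⟩ ∈ A then false else τ₀ x
  have hτ (l : Literal) (hl : l ∈ A) : τ l.var = l.sign := by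
    obtain ⟨x, _ | _⟩ := l
    · have : (⟨x, true⟩ : Literal) ∉ A := hA.2 _ hl
      simp [τ, this, hl]
    · simp [τ, hl]
  have hτ₀ (l : Literal) (hl : l ∉ A) (hl' : l.neg ∉ A) : τ l.var = τ₀ l.var := by
    obtain ⟨x, _ | _⟩ := l <;> simp_all [τ, Literal.neg]
  refine ⟨τ, fun c hc => ?_, hτ⟩
  have hc' := List.mem_map_of_mem (f := Clause.lits) hc
  have hsub : ∀ l ∈ live Literal.neg A c.lits, l ∈ c.lits ∧ l.neg ∉ A := fun l hl => by
    simpa [live] using hl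
  by_cases h : ∃ l ∈ live Literal.neg A c.lits, l ∈ A
  · obtain ⟨l, hl, hlA⟩ := h
    exact ⟨l, (hsub l hl).1, hτ l hlA⟩
  · push Not at h
    obtain ⟨l, hl, hl₀⟩ := h₀ c hc (by
      have hne := hA.1 _ hc'
      have hst := hs _ hc'
      match e : live Literal.neg A c.lits with
      | [] => exact absurd e hne
      | [x] =>
        refine absurd (hst (by rw [e]; rfl) ?_) (h x ?_) <;> simp [e]
      | _ :: _ :: _ => simp)
    exact ⟨l, (hsub l hl).1, (hτ₀ l (h l hl) (hsub l hl).2).trans hl₀⟩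

/-- Unit propagation decides whether a satisfiable Krom formula or a Horn formula is satisfiable
together with given literals: after propagation without a conflict, a clause that is not yet
satisfied has two live literals. In a Krom formula these are all its literals, and the clause is
satisfied by any solution of the formula; in a Horn formula one of them is negative, and the clause
is satisfied if all remaining variables are false. -/
theorem conflictFree_closure_iff {Γ : CNF} (hΓ : Γ ∈ Krom ∨ Γ ∈ Horn)
    (hsat : ∃ τ, CNF.Holds Γ τ) (S : List Literal) :
    conflictFree Literal.neg (Γ.map Clause.lits)
        (closure Literal.neg (Γ.map Clause.lits) S) = true ↔
      ∃ τ, CNF.Holds Γ τ ∧ ∀ l ∈ S, τ l.var = l.sign := by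
  constructor
  · intro h
    have hs := stable_closure (neg := Literal.neg) (Γ.map Clause.lits) S
    suffices ∃ τ, CNF.Holds Γ τ ∧
        ∀ l ∈ closure Literal.neg (Γ.map Clause.lits) S, τ l.var = l.sign from
      this.imp fun τ hτ => ⟨hτ.1, fun l hl => hτ.2 l (subset_closure _ _ hl)⟩
    have hsub (c : Clause) : (live Literal.neg (closure Literal.neg (Γ.map Clause.lits) S)
        c.lits).Sublist c.lits := List.filter_sublist
    rcases hΓ with hΓ | hΓ
    · obtain ⟨τ₀, hτ₀⟩ := hsat
      refine exists_holds_of_conflictFree hs h τ₀ fun c hc h₂ => ?_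
      rw [(hsub c).eq_of_length_le ((hΓ c hc).trans h₂)]
      exact hτ₀ c hc
    · refine exists_holds_of_conflictFree hs h (fun _ => false) fun c hc h₂ => ?_
      by_contra! hn
      have hpos : (live Literal.neg (closure Literal.neg (Γ.map Clause.lits) S)
          c.lits).filter (fun l => l.sign) = _ := List.filter_eq_self.2 fun l hl => by
        simpa using hn l hl
      have := ((hsub c).filter fun l => l.sign).length_le
      rw [hpos] at this
      have := hΓ c hc
      omega
  · rintro ⟨τ, hτ, hS⟩
    have hv (l : Literal) : τ l.neg.var = l.neg.sign ↔ ¬ τ l.var = l.sign := by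
      cases h : l.sign <;> simp [Literal.neg, h]
    have hc : ∀ c ∈ Γ.map Clause.lits, ∃ l ∈ c, τ l.var = l.sign := by
      exact List.forall_mem_map.2 hτ
    have hA := closure_sound (v := fun l : Literal => τ l.var = l.sign) hv hc hS
    have hneg (l : Literal) (hl : τ l.var = l.sign) :
        l.neg ∉ closure Literal.neg (Γ.map Clause.lits) S := fun h => (hv l).1 (hA _ h) hl
    simp only [conflictFree, Bool.and_eq_true, List.all_eq_true, Bool.not_eq_true',
      decide_eq_false_iff_not, List.isEmpty_eq_false_iff]
    refine ⟨fun c h => ?_, fun l hl => hneg l (hA l hl)⟩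
    obtain ⟨l, hl, hlτ⟩ := hc c h
    exact List.ne_nil_of_mem (a := l) (by simpa [live] using ⟨hl, hneg l hlτ⟩)

/-! ### The ranking of the literals -/

/-- The literals that a partial ballot makes true. -/
def PartialBallot.lits {n : ℕ} (s : PartialBallot n) : List (IssueLit n) :=
  (List.finRange n).flatMap fun i => match s i with
    | some b => [(i, b)]
    | none => []

theorem PartialBallot.mem_lits {n : ℕ} {s : PartialBallot n} {l : IssueLit n} :
    l ∈ s.lits ↔ s l.1 = some l.2 := by
  obtain ⟨i, b⟩ := l
  simp only [lits, List.mem_flatMap, List.mem_finRange, true_and]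
  constructor
  · rintro ⟨j, hj⟩
    cases h : s j <;> simp_all
  · intro h
    exact ⟨i, by simp_all⟩

/-- The literals that a ballot makes true. -/
def Ballot.lits {n : ℕ} (r : Ballot n) : List (IssueLit n) :=
  PartialBallot.lits fun i => some (r i)

theorem majorityStrength_eq {n : ℕ} (profile : List (Ballot n)) (l : IssueLit n) :
    majorityStrength profile l =
      ((profile.map Ballot.lits).filter fun r => decide (l ∈ r)).length := by
  rw [majorityStrength, List.countP_eq_length_filter, List.filter_map, List.length_map]
  congr 2
  funext r
  rw [Bool.eq_iff_iff]
  simp [Ballot.lits, PartialBallot.mem_lits]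

theorem List.pairwise_tails {α : Type} (l : List α) :
    l.tails.Pairwise fun s t => t.length < s.length := by
  induction l with
  | nil => simp
  | cons x l ih =>
    rw [List.tails_cons, List.pairwise_cons]
    refine ⟨fun t ht => ?_, ih⟩
    have := ((List.mem_tails _ _).1 ht).length_le
    rw [List.length_cons]
    omega

theorem List.exists_mem_tails_length {α : Type} (l : List α) {k : ℕ} (hk : k ≤ l.length) :
    ∃ t ∈ l.tails, t.length = k :=
  ⟨l.drop (l.length - k), (List.mem_tails _ _).2 (List.drop_suffix _ _), by
    rw [List.length_drop]; omega⟩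

open UnitPropagation in
/-- Both lists are sorted by `strengthLE`, which is antisymmetric on the entries of `tb`. -/
theorem ranked_eq_rankedLits {n : ℕ} {tb : List (IssueLit n)} (htb : tb.Nodup)
    (profile : List (Ballot n)) :
    ranked tb (profile.map Ballot.lits) = rankedLits tb profile := by
  have e : ranked tb (profile.map Ballot.lits) = profile.tails.flatMap fun t =>
      tb.filter fun l => decide (majorityStrength profile l = t.length) := by
    rw [ranked, List.map_tails, List.flatMap_map]
    congr 1
    funext t
    congr 1
    funext l
    -- The two sides differ in the way in which membership is decided.
    exact decide_eq_decide.2 (by rw [List.length_map, majorityStrength_eq]; congr!)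
  have hidx : tb.Pairwise fun l₁ l₂ => tb.idxOf l₁ < tb.idxOf l₂ := by
    rw [List.pairwise_iff_getElem]
    intro i j hi hj hij
    rwa [htb.idxOf_getElem, htb.idxOf_getElem]
  have hsorted : (ranked tb (profile.map Ballot.lits)).Pairwise fun l₁ l₂ =>
      majorityStrength profile l₁ > majorityStrength profile l₂ ∨
        majorityStrength profile l₁ = majorityStrength profile l₂ ∧
          tb.idxOf l₁ < tb.idxOf l₂ := by
    rw [e, List.pairwise_flatMap]
    refine ⟨fun t _ => (hidx.filter _).imp_of_mem fun h₁ h₂ h => ?_,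
      (List.pairwise_tails profile).imp fun {s t} h l₁ h₁ l₂ h₂ => ?_⟩
    · simp only [List.mem_filter, decide_eq_true_eq] at h₁ h₂
      exact .inr ⟨h₁.2.trans h₂.2.symm, h⟩
    · simp only [List.mem_filter, decide_eq_true_eq] at h₁ h₂
      exact .inl (by omega)
  have hnodup : (ranked tb (profile.map Ballot.lits)).Nodup := hsorted.imp fun h heq => by
    subst heq; omega
  have hperm : (ranked tb (profile.map Ballot.lits)).Perm tb := by
    rw [List.perm_ext_iff_of_nodup hnodup htb, e]
    intro l
    simp only [List.mem_flatMap, List.mem_filter, decide_eq_true_eq]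
    refine ⟨fun ⟨_, _, h, _⟩ => h, fun h => ?_⟩
    obtain ⟨t, ht, hl⟩ := List.exists_mem_tails_length profile
      (k := majorityStrength profile l) List.countP_le_length
    exact ⟨t, ht, h, hl.symm⟩
  refine List.Perm.eq_of_pairwise (le := strengthLE tb profile) ?_ ?_ ?_
    (hperm.trans (List.mergeSort_perm _ _).symm)
  · intro l₁ l₂ h₁ _ h h'
    refine (List.idxOf_inj (hperm.subset h₁)).1 ?_
    unfold strengthLE at h h'
    omega
  · exact hsorted.imp fun h => by unfold strengthLE; omega
  · refine (List.pairwise_mergeSort ?_ ?_ tb).imp fun h => by simpa using h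
    · intro a b c h h'
      simp only [decide_eq_true_eq] at h h' ⊢
      unfold strengthLE at h h' ⊢
      omega
    · intro a b
      simp only [Bool.or_eq_true, decide_eq_true_eq]
      unfold strengthLE
      omega

/-! ### The ranked agenda procedure as an algorithm on lists of literals -/

/-- The propositional literal that belongs to a literal over the issues. -/
def IssueLit.toLiteral {n : ℕ} (issue : Fin n → ℕ) (l : IssueLit n) : Literal := ⟨issue l.1, l.2⟩

theorem IssueLit.toLiteral_injective {n : ℕ} {issue : Fin n → ℕ}
    (hi : Function.Injective issue) : Function.Injective (IssueLit.toLiteral issue) := by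
  rintro ⟨i, b⟩ ⟨j, b'⟩ h
  simp only [IssueLit.toLiteral, Literal.mk.injEq] at h
  rw [hi h.1, h.2]

/-- The list `S` consists of the literals that the partial ballot `s` makes true. -/
def Represents {n : ℕ} (issue : Fin n → ℕ) (S : List Literal) (s : PartialBallot n) : Prop :=
  ∀ l : Literal, l ∈ S ↔ ∃ i b, s i = some b ∧ l = ⟨issue i, b⟩

section

open UnitPropagation Function

variable {n : ℕ} {issue : Fin n → ℕ} {Γ : CNF}

theorem represents_accept (hΓ : Γ ∈ Krom ∨ Γ ∈ Horn)
    (hsat : ∃ τ, CNF.Holds Γ τ) {S : List Literal} {s : PartialBallot n}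
    (h : Represents issue S s) (l : IssueLit n) :
    Represents issue (accept Literal.neg (Γ.map Clause.lits) S (l.toLiteral issue))
      (tidemanStep issue Γ s l) := by
  obtain ⟨i, b⟩ := l
  have key : (∃ τ, CNF.Holds Γ τ ∧ ∀ k ∈ IssueLit.toLiteral issue (i, b) :: S,
        τ k.var = k.sign) ↔
      s i ≠ some (!b) ∧ PartialBallot.Consistent issue Γ (update s i (some b)) := by
    constructor
    · rintro ⟨τ, hτ, hS⟩
      have hb : τ (issue i) = b := hS ⟨issue i, b⟩ List.mem_cons_self
      have hs (j c) (hj : s j = some c) : τ (issue j) = c :=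
        hS ⟨issue j, c⟩ (List.mem_cons_of_mem _ ((h _).2 ⟨j, c, hj, rfl⟩))
      refine ⟨fun hb' => ?_, τ, fun j c hj => ?_, hτ⟩
      · have := hs i _ hb'
        rw [hb] at this
        cases b <;> simp at this
      · by_cases hji : j = i
        · subst hji
          rw [update_self, Option.some_inj] at hj
          rwa [← hj]
        · rw [update_of_ne hji] at hj
          exact hs j c hj
    · rintro ⟨hb, τ, hs, hτ⟩
      refine ⟨τ, hτ, fun k hk => ?_⟩
      rcases List.mem_cons.1 hk with rfl | hk
      · exact hs i b (update_self ..)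
      · obtain ⟨j, c, hj, rfl⟩ := (h k).1 hk
        refine hs j c ?_
        by_cases hji : j = i
        · subst hji
          rw [update_self, ← hj]
          rw [hj, ne_eq, Option.some_inj] at hb
          rw [hj]
          cases b <;> cases c <;> simp_all
        · rwa [update_of_ne hji]
  rw [accept, tidemanStep]
  by_cases hc : s i ≠ some (!b) ∧ PartialBallot.Consistent issue Γ (update s i (some b))
  · rw [if_pos hc, if_pos ((conflictFree_closure_iff hΓ hsat _).2 (key.2 hc))]
    intro k
    rw [List.mem_cons, h k]
    constructor
    · rintro (rfl | ⟨j, c, hj, rfl⟩)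
      · exact ⟨i, b, update_self .., rfl⟩
      · by_cases hji : j = i
        · subst hji
          refine ⟨j, b, update_self .., ?_⟩
          have := hc.1
          rw [hj] at this
          cases b <;> cases c <;> simp_all
        · exact ⟨j, c, by rwa [update_of_ne hji], rfl⟩
    · rintro ⟨j, c, hj, rfl⟩
      by_cases hji : j = i
      · subst hji
        rw [update_self, Option.some_inj] at hj
        exact .inl (by rw [← hj]; rfl)
      · rw [update_of_ne hji] at hj
        exact .inr ⟨j, c, hj, rfl⟩
  · rw [if_neg hc, if_neg fun h' => hc (key.1 ((conflictFree_closure_iff hΓ hsat _).1 h'))]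
    exact h

theorem represents_foldl (hΓ : Γ ∈ Krom ∨ Γ ∈ Horn)
    (hsat : ∃ τ, CNF.Holds Γ τ) (L : List (IssueLit n)) {S : List Literal} {s : PartialBallot n}
    (h : Represents issue S s) :
    Represents issue
      ((L.map (IssueLit.toLiteral issue)).foldl (accept Literal.neg (Γ.map Clause.lits)) S)
      (L.foldl (tidemanStep issue Γ) s) := by
  induction L generalizing S s with
  | nil => exact h
  | cons l L ih => exact ih (represents_accept hΓ hsat h l)

theorem tidemanStep_consistent {s : PartialBallot n} (h : PartialBallot.Consistent issue Γ s)
    (l : IssueLit n) : PartialBallot.Consistent issue Γ (tidemanStep issue Γ s l) := by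
  unfold tidemanStep
  split
  next h' => exact h'.2
  next => exact h

theorem foldl_tidemanStep_consistent (L : List (IssueLit n)) {s : PartialBallot n}
    (h : PartialBallot.Consistent issue Γ s) :
    PartialBallot.Consistent issue Γ (L.foldl (tidemanStep issue Γ) s) := by
  induction L generalizing s with
  | nil => exact h
  | cons l L ih => exact ih (tidemanStep_consistent h l)

theorem tidemanStep_eq_some {s : PartialBallot n} {i : Fin n} {b : Bool} (h : s i = some b)
    (l : IssueLit n) : tidemanStep issue Γ s l i = some b := by
  unfold tidemanStep
  split
  next h' =>
    by_cases hl : i = l.1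
    · subst hl
      have := h'.1
      rw [update_self]
      cases hl2 : l.2 <;> cases b <;> simp_all
    · rwa [update_of_ne hl]
  next => exact h

/-- The values that have been set remain unchanged. -/
theorem foldl_tidemanStep_eq_some (L : List (IssueLit n)) {s : PartialBallot n} {i : Fin n}
    {b : Bool} (h : s i = some b) : L.foldl (tidemanStep issue Γ) s i = some b := by
  induction L generalizing s with
  | nil => exact h
  | cons l L ih => exact ih (tidemanStep_eq_some h l)

/-- The result is a total ballot: it is consistent, so one of the two literals over any issue could
be set to true when its turn came. -/
theorem foldl_tidemanStep_ne_none {L : List (IssueLit n)} (hL : ∀ l, l ∈ L)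
    {s : PartialBallot n} (h : PartialBallot.Consistent issue Γ s) (i : Fin n) :
    L.foldl (tidemanStep issue Γ) s i ≠ none := by
  obtain ⟨τ, hτ, hΓ⟩ := foldl_tidemanStep_consistent L h
  obtain ⟨L₁, L₂, e⟩ := List.append_of_mem (hL (i, τ (issue i)))
  rw [e, List.foldl_append, List.foldl_cons] at hτ ⊢
  set s₁ := L₁.foldl (tidemanStep issue Γ) s
  suffices ∃ b, tidemanStep issue Γ s₁ (i, τ (issue i)) i = some b by
    obtain ⟨b, hb⟩ := this
    simp [foldl_tidemanStep_eq_some L₂ hb]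
  cases hs : s₁ i with
  | some b => exact ⟨b, tidemanStep_eq_some hs _⟩
  | none =>
    refine ⟨τ (issue i), ?_⟩
    rw [tidemanStep, if_pos, update_self]
    refine ⟨by simp [hs], τ, fun j b hj => ?_, hΓ⟩
    by_cases hji : j = i
    · subst hji
      simpa using hj
    · rw [update_of_ne hji] at hj
      exact hτ j b (foldl_tidemanStep_eq_some L₂ (tidemanStep_eq_some hj _))

end

open UnitPropagation in
/-- The algorithm answers the question, if ballots are presented as lists of literals. -/
theorem outcomeTideman_iff_answer (I : OutcomeInstance)
    (hΓ : I.constraint ∈ Krom ∨ I.constraint ∈ Horn) :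
    OutcomeTideman I ↔ answer Literal.neg (I.constraint.map Clause.lits)
      ((ranked I.tb (I.profile.map Ballot.lits)).map (IssueLit.toLiteral I.issue))
      ((PartialBallot.lits I.target).map (IssueLit.toLiteral I.issue)) = true := by
  obtain ⟨r₀, hr₀⟩ := List.exists_mem_of_ne_nil _ I.profile_ne_nil
  obtain ⟨τ, _, hτ⟩ := I.profile_rational r₀ hr₀
  have hcons : PartialBallot.Consistent I.issue I.constraint (fun _ => none) :=
    ⟨τ, fun _ _ h => by simp at h, hτ⟩
  have htb : ∀ l, l ∈ rankedLits I.tb I.profile := fun l =>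
    (List.mergeSort_perm _ _).symm.subset (I.tb_complete l)
  have hrep := represents_foldl (issue := I.issue) hΓ ⟨τ, hτ⟩
    (rankedLits I.tb I.profile) (S := []) (s := fun _ => none) (fun l => by simp)
  have htotal := foldl_tidemanStep_ne_none htb hcons
  rw [ranked_eq_rankedLits I.tb_nodup]
  set s := (rankedLits I.tb I.profile).foldl (tidemanStep I.issue I.constraint) fun _ => none
    with hs
  have key : OutcomeTideman I ↔ ∀ i b, I.target i = some b → s i = some b := by
    constructor
    · rintro ⟨r, hr, h⟩ i b hb
      have hr : s = fun i => some (r i) := hr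
      rw [hr]
      exact congrArg some (h i b hb)
    · intro h
      choose r hr using fun i => Option.ne_none_iff_exists'.1 (htotal i)
      exact ⟨r, funext hr, fun i b hb => Option.some_inj.1 ((hr i).symm.trans (h i b hb))⟩
  rw [key]
  simp only [answer, List.all_eq_true, decide_eq_true_eq, List.forall_mem_map]
  unfold outcome
  constructor
  · intro h l hl
    exact (hrep _).2 ⟨l.1, l.2, h _ _ (PartialBallot.mem_lits.1 hl), rfl⟩
  · intro h i b hb
    obtain ⟨j, c, hj, e⟩ := (hrep _).1 (h (i, b) (PartialBallot.mem_lits.2 hb))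
    simp only [IssueLit.toLiteral, Literal.mk.injEq] at e
    rw [I.issue_injective e.1, e.2, hj]

/-! ### The algorithm does not depend on how literals are presented -/

namespace UnitPropagation

variable {α β : Type} [DecidableEq α] [DecidableEq β] {neg : α → α} {neg' : β → β} {e : α → β}

theorem live_map (he : Function.Injective e) (hn : ∀ l, neg' (e l) = e (neg l)) (A c : List α) :
    live neg' (A.map e) (c.map e) = (live neg A c).map e := by
  simp only [live, List.filter_map]
  congr 2
  funext l
  simp [hn, he.eq_iff]

theorem propagate_map (he : Function.Injective e) (hn : ∀ l, neg' (e l) = e (neg l))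
    (A c : List α) : propagate neg' (A.map e) (c.map e) = (propagate neg A c).map e := by
  rw [propagate, propagate, live_map he hn, ← List.map_tail, List.isEmpty_map]
  split
  · rw [List.map_append, List.filter_map]
    congr 3
    funext l
    simp [he.eq_iff]
  · rfl

theorem round_map (he : Function.Injective e) (hn : ∀ l, neg' (e l) = e (neg l))
    (Γ : List (List α)) (A : List α) :
    round neg' (Γ.map (List.map e)) (A.map e) = (round neg Γ A).map e := by
  unfold round
  induction Γ generalizing A with
  | nil => rfl
  | cons c Γ ih => rw [List.map_cons, List.foldl_cons, propagate_map he hn, ih, List.foldl_cons]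

theorem closure_map (he : Function.Injective e) (hn : ∀ l, neg' (e l) = e (neg l))
    (Γ : List (List α)) (A : List α) :
    closure neg' (Γ.map (List.map e)) (A.map e) = (closure neg Γ A).map e := by
  have key (L : List (List α)) (A : List α) :
      (L.map (List.map e)).foldl (fun A _ => round neg' (Γ.map (List.map e)) A) (A.map e) =
        (L.foldl (fun A _ => round neg Γ A) A).map e := by
    induction L generalizing A with
    | nil => rfl
    | cons c L ih => rw [List.map_cons, List.foldl_cons, round_map he hn, ih, List.foldl_cons]
  exact key Γ A

theorem conflictFree_map (he : Function.Injective e) (hn : ∀ l, neg' (e l) = e (neg l))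
    (Γ : List (List α)) (A : List α) :
    conflictFree neg' (Γ.map (List.map e)) (A.map e) = conflictFree neg Γ A := by
  simp only [conflictFree, List.all_map]
  congr 2
  · funext c
    simp [live_map he hn]
  · funext l
    simp [hn, he.eq_iff]

theorem accept_map (he : Function.Injective e) (hn : ∀ l, neg' (e l) = e (neg l))
    (Γ : List (List α)) (S : List α) (l : α) :
    accept neg' (Γ.map (List.map e)) (S.map e) (e l) = (accept neg Γ S l).map e := by
  rw [accept, accept, ← List.map_cons, closure_map he hn, conflictFree_map he hn]
  split <;> rfl

theorem outcome_map (he : Function.Injective e) (hn : ∀ l, neg' (e l) = e (neg l))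
    (Γ : List (List α)) (L : List α) :
    outcome neg' (Γ.map (List.map e)) (L.map e) = (outcome neg Γ L).map e := by
  have key (S : List α) : (L.map e).foldl (accept neg' (Γ.map (List.map e))) (S.map e) =
      (L.foldl (accept neg Γ) S).map e := by
    induction L generalizing S with
    | nil => rfl
    | cons l L ih => rw [List.map_cons, List.foldl_cons, accept_map he hn, ih, List.foldl_cons]
  exact key []

theorem answer_map (he : Function.Injective e) (hn : ∀ l, neg' (e l) = e (neg l))
    (Γ : List (List α)) (L target : List α) :
    answer neg' (Γ.map (List.map e)) (L.map e) (target.map e) = answer neg Γ L target := by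
  rw [answer, answer, outcome_map he hn, List.all_map]
  congr 1
  funext l
  simp [he.eq_iff]

theorem ranked_map (he : Function.Injective e) (tb : List α) (ballots : List (List α)) :
    ranked (tb.map e) (ballots.map (List.map e)) = (ranked tb ballots).map e := by
  simp only [ranked, List.map_tails, List.flatMap_map, List.map_flatMap, List.filter_map,
    List.length_map, Function.comp_def, List.mem_map_of_injective he]

end UnitPropagation

/-! ### Parsing -/

/-- Split a word before the symbols that pass the test `p`. The first component is what precedes the
first of these symbols, the second component is the list of the other parts. -/
def splitBefore {A : Type} (p : A → Bool) (w : List A) : List A × List (List A) :=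
  w.foldr (fun x s => if p x then ([], (x :: s.1) :: s.2) else (x :: s.1, s.2)) ([], [])

section splitBefore

variable {A : Type} {p : A → Bool}

theorem splitBefore_append {u : List A} (hu : ∀ x ∈ u, p x = false) (w : List A) :
    splitBefore p (u ++ w) = (u ++ (splitBefore p w).1, (splitBefore p w).2) := by
  induction u with
  | nil => rfl
  | cons x u ih =>
    have := ih fun y hy => hu y (by simp [hy])
    unfold splitBefore at this ⊢
    rw [List.cons_append, List.foldr_cons, this]
    simp [hu x]

theorem splitBefore_cons {x : A} (hx : p x = true) (w : List A) :
    splitBefore p (x :: w) = ([], (x :: (splitBefore p w).1) :: (splitBefore p w).2) := by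
  simp [splitBefore, hx]

theorem splitBefore_of_forall {u : List A} (hu : ∀ x ∈ u, p x = false) :
    splitBefore p u = (u, []) := by
  have := splitBefore_append hu []
  simpa [splitBefore] using this

theorem splitBefore_flatMap {B : Type} (L : List B) (f : B → A) (g : B → List A)
    (hf : ∀ b, p (f b) = true) (hg : ∀ b, ∀ x ∈ g b, p x = false) :
    splitBefore p (L.flatMap fun b => f b :: g b) = ([], L.map fun b => f b :: g b) := by
  induction L with
  | nil => rfl
  | cons b L ih =>
    rw [List.flatMap_cons, List.cons_append, splitBefore_cons (hf b), splitBefore_append (hg b), ih]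
    simp

end splitBefore

/-- Flip the sign of a literal. -/
def InputSym.neg : InputSym → InputSym
  | sign b => sign (!b)
  | s => s

/-- The complementary literal, on the level of words: the sign comes first. -/
def negWord : List InputSym → List InputSym
  | [] => []
  | s :: t => s.neg :: t

theorem negWord_encodeLiteral (l : Literal) :
    negWord (encodeLiteral l) = encodeLiteral l.neg := rfl

theorem encodeVar_injective : Function.Injective encodeVar := by
  intro x y h
  have h : Computability.encodeNat x = Computability.encodeNat y :=
    List.map_injective_iff.2 (fun a b h => InputSym.bit.inj h) h
  rw [← Computability.decode_encodeNat x, h, Computability.decode_encodeNat]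

theorem encodeLiteral_injective : Function.Injective encodeLiteral := by
  rintro ⟨x, b⟩ ⟨y, c⟩ h
  simp only [encodeLiteral, List.cons.injEq, InputSym.sign.injEq] at h
  rw [h.1, encodeVar_injective h.2]

/-- The words of the literals that a partial ballot makes true, given the names of the issues and
the entries of the partial ballot. -/
def litWords (names : List (List InputSym)) (entries : List InputSym) : List (List InputSym) :=
  (names.zip entries).flatMap fun q => match q.2 with
    | .bit b => [.sign b :: q.1]
    | _ => []

theorem litWords_eq {n : ℕ} (issue : Fin n → ℕ) (s : PartialBallot n) :
    litWords ((List.ofFn issue).map encodeVar) ((List.ofFn s).map encodeEntry) =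
      (s.lits.map (IssueLit.toLiteral issue)).map encodeLiteral := by
  rw [litWords, PartialBallot.lits, List.ofFn_eq_map, List.ofFn_eq_map, List.map_map, List.map_map,
    List.zip_map', List.flatMap_map, List.map_flatMap, List.map_flatMap]
  congr 1
  funext i
  cases h : s i <;> simp [h, encodeEntry, encodeLiteral, IssueLit.toLiteral]

/-- The symbols with which literals begin. -/
def InputSym.isSign : InputSym → Bool
  | .sign _ => true
  | _ => false

/-- The parts of a word that follow its separators. -/
def sections (w : List InputSym) : List (List InputSym) :=
  (splitBefore (fun x => decide (x = .sep)) w).2.map List.tail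

/-- The names of the issues. -/
def parseIssues (w : List InputSym) : List (List InputSym) :=
  (splitBefore (fun x => decide (x = .issue))
    (splitBefore (fun x => decide (x = .sep)) w).1).2.map List.tail

/-- The clauses of the integrity constraint. -/
def parseConstraint (w : List InputSym) : List (List (List InputSym)) :=
  (splitBefore (fun x => decide (x = .clause)) ((sections w).headD [])).2.map fun c =>
    (splitBefore InputSym.isSign c).2

/-- The literals over the issues, in the tie-breaking order. -/
def parseTieBreak (w : List InputSym) : List (List InputSym) :=
  (splitBefore InputSym.isSign ((sections w).tail.headD [])).2

/-- The ballots, as lists of literals. -/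
def parseProfile (w : List InputSym) : List (List (List InputSym)) :=
  (splitBefore (fun x => decide (x = .ballot)) ((sections w).tail.tail.headD [])).2.map fun r =>
    litWords (parseIssues w) r.tail

/-- The literals that the target makes true. -/
def parseTarget (w : List InputSym) : List (List InputSym) :=
  litWords (parseIssues w) ((sections w).tail.tail.tail.headD [])

theorem forall_mem_encodeVar {q : InputSym → Prop} (hq : ∀ b, q (.bit b)) (x : ℕ) :
    ∀ y ∈ encodeVar x, q y := by
  intro y hy
  obtain ⟨b, _, rfl⟩ := List.mem_map.1 hy
  exact hq b

theorem forall_mem_encodeLiteral {q : InputSym → Prop} (hq : ∀ b, q (.bit b))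
    (hq' : ∀ b, q (.sign b)) (l : Literal) : ∀ y ∈ encodeLiteral l, q y := by
  simpa [encodeLiteral] using ⟨hq' _, forall_mem_encodeVar hq _⟩

section parse

variable (I : OutcomeInstance)

/-- The separators of the encoding of an instance delimit its five parts. -/
theorem encode_eq : ∃ s₁ s₂ s₃ s₄ s₅ : List InputSym,
    splitBefore (fun x => decide (x = .sep)) I.encode =
        (s₁, [.sep :: s₂, .sep :: s₃, .sep :: s₄, .sep :: s₅]) ∧
      s₁ = (List.ofFn I.issue).flatMap (fun x => InputSym.issue :: encodeVar x) ∧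
      s₂ = encodeCNF I.constraint ∧
      s₃ = I.tb.flatMap (fun l => encodeLiteral ⟨I.issue l.1, l.2⟩) ∧
      s₄ = I.profile.flatMap (fun r => InputSym.ballot :: (List.ofFn r).map InputSym.bit) ∧
      s₅ = (List.ofFn I.target).map encodeEntry := by
  refine ⟨_, _, _, _, _, ?_, rfl, rfl, rfl, rfl, rfl⟩
  unfold OutcomeInstance.encode
  simp only [List.append_assoc]
  have h (x : InputSym) : decide (x = .sep) = false ↔ x ≠ .sep := by simp
  rw [splitBefore_append, List.singleton_append, splitBefore_cons (by simp), splitBefore_append,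
    List.singleton_append, splitBefore_cons (by simp), splitBefore_append,
    List.singleton_append, splitBefore_cons (by simp), splitBefore_append,
    List.singleton_append, splitBefore_cons (by simp), splitBefore_of_forall]
  · simp
  · intro x hx
    obtain ⟨o, _, rfl⟩ := List.mem_map.1 hx
    cases o <;> rfl
  · intro x hx
    obtain ⟨r, _, hx⟩ := List.mem_flatMap.1 hx
    rcases List.mem_cons.1 hx with rfl | hx
    · rfl
    · obtain ⟨o, _, rfl⟩ := List.mem_map.1 hx
      rfl
  · intro x hx
    obtain ⟨l, _, hx⟩ := List.mem_flatMap.1 hx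
    exact forall_mem_encodeLiteral (q := fun x => decide (x = .sep) = false) (fun _ => rfl)
      (fun _ => rfl) _ x hx
  · intro x hx
    obtain ⟨c, _, hx⟩ := List.mem_flatMap.1 hx
    rcases List.mem_cons.1 hx with rfl | hx
    · rfl
    · obtain ⟨l, _, hx⟩ := List.mem_flatMap.1 hx
      exact forall_mem_encodeLiteral (q := fun x => decide (x = .sep) = false) (fun _ => rfl)
        (fun _ => rfl) _ x hx
  · intro x hx
    obtain ⟨y, _, hx⟩ := List.mem_flatMap.1 hx
    rcases List.mem_cons.1 hx with rfl | hx
    · rfl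
    · exact forall_mem_encodeVar (q := fun x => decide (x = .sep) = false) (fun _ => rfl) _ x hx

theorem parseIssues_encode : parseIssues I.encode = (List.ofFn I.issue).map encodeVar := by
  obtain ⟨s₁, s₂, s₃, s₄, s₅, h, rfl, rfl, rfl, rfl, rfl⟩ := encode_eq I
  rw [parseIssues, h, splitBefore_flatMap _ (fun _ => .issue) encodeVar (fun _ => rfl)
    fun x => forall_mem_encodeVar (fun _ => rfl) x, List.map_map]
  rfl

theorem sections_encode : sections I.encode = [encodeCNF I.constraint,
    I.tb.flatMap (fun l => encodeLiteral ⟨I.issue l.1, l.2⟩),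
    I.profile.flatMap (fun r => InputSym.ballot :: (List.ofFn r).map InputSym.bit),
    (List.ofFn I.target).map encodeEntry] := by
  obtain ⟨s₁, s₂, s₃, s₄, s₅, h, rfl, rfl, rfl, rfl, rfl⟩ := encode_eq I
  rw [sections, h]
  rfl

theorem splitBefore_isSign_flatMap {B : Type} (L : List B) (f : B → Literal) :
    splitBefore InputSym.isSign (L.flatMap fun b => encodeLiteral (f b)) =
      ([], L.map fun b => encodeLiteral (f b)) :=
  splitBefore_flatMap L (fun b => .sign (f b).sign) (fun b => encodeVar (f b).var) (fun _ => rfl)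
    fun _ => forall_mem_encodeVar (fun _ => rfl) _

theorem parseConstraint_encode : parseConstraint I.encode =
    (I.constraint.map Clause.lits).map (List.map encodeLiteral) := by
  rw [parseConstraint, sections_encode, List.headD_cons, encodeCNF,
    splitBefore_flatMap _ (fun _ => .clause) (fun c : Clause => c.lits.flatMap encodeLiteral)
    (fun _ => rfl) fun c x hx => ?_, List.map_map, List.map_map]
  · refine List.map_congr_left fun c _ => ?_
    have := splitBefore_append (p := InputSym.isSign) (u := [.clause]) (by simp [InputSym.isSign])
      (c.lits.flatMap encodeLiteral)
    rw [splitBefore_isSign_flatMap c.lits fun l => l] at this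
    exact congrArg Prod.snd this
  · obtain ⟨l, _, hx⟩ := List.mem_flatMap.1 hx
    exact forall_mem_encodeLiteral (q := fun x => decide (x = .clause) = false) (fun _ => rfl)
      (fun _ => rfl) _ x hx

theorem parseTieBreak_encode : parseTieBreak I.encode =
    (I.tb.map (IssueLit.toLiteral I.issue)).map encodeLiteral := by
  rw [parseTieBreak, sections_encode, List.tail_cons, List.headD_cons,
    splitBefore_isSign_flatMap I.tb fun l => ⟨I.issue l.1, l.2⟩, List.map_map]
  rfl

theorem parseProfile_encode : parseProfile I.encode =
    ((I.profile.map Ballot.lits).map (List.map (IssueLit.toLiteral I.issue))).map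
      (List.map encodeLiteral) := by
  rw [parseProfile, parseIssues_encode, sections_encode, List.tail_cons, List.tail_cons,
    List.headD_cons, splitBefore_flatMap _ (fun _ => .ballot)
      (fun r : Ballot I.n => (List.ofFn r).map InputSym.bit) (fun _ => rfl) fun _ x hx => ?_,
    List.map_map, List.map_map, List.map_map]
  · refine List.map_congr_left fun r _ => ?_
    rw [Function.comp_apply, List.tail_cons, Function.comp_apply, Function.comp_apply, Ballot.lits,
      ← litWords_eq]
    simp [List.ofFn_eq_map, encodeEntry, Function.comp_def]
  · obtain ⟨_, _, rfl⟩ := List.mem_map.1 hx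
    rfl

theorem parseTarget_encode : parseTarget I.encode =
    ((PartialBallot.lits I.target).map (IssueLit.toLiteral I.issue)).map encodeLiteral := by
  rw [parseTarget, parseIssues_encode, sections_encode, ← litWords_eq]
  rfl

end parse

open UnitPropagation in
/-- The algorithm on the level of words. -/
def decideOutcome (w : List InputSym) : Bool :=
  answer negWord (parseConstraint w) (ranked (parseTieBreak w) (parseProfile w)) (parseTarget w)

open UnitPropagation in
theorem decideOutcome_encode (I : OutcomeInstance)
    (hΓ : I.constraint ∈ Krom ∨ I.constraint ∈ Horn) :
    decideOutcome I.encode = true ↔ OutcomeTideman I := by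
  rw [outcomeTideman_iff_answer I hΓ, decideOutcome, parseConstraint_encode, parseTieBreak_encode,
    parseProfile_encode, parseTarget_encode, ranked_map encodeLiteral_injective,
    ranked_map (IssueLit.toLiteral_injective I.issue_injective),
    answer_map encodeLiteral_injective negWord_encodeLiteral]

/-! ### Parsing takes polynomial time -/

section

open TreeCode PolyTime

variable {γ : Type} [TreeCode γ]

theorem polyTime_splitBefore (p : InputSym → Bool) {w : γ → List InputSym} (hw : PolyTime w) :
    PolyTime fun c => splitBefore p (w c) := by
  obtain ⟨Q, hQ⟩ := exists_size_le_of_mem (f := fun _ x => x) hw snd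
  have hs : PolyTime fun q : (γ × List InputSym × List (List InputSym)) × InputSym => q.1.2 :=
    snd.comp fst
  have hc : PolyTime fun q : (γ × List InputSym × List (List InputSym)) × InputSym =>
      q.2 :: q.1.2.1 := cons snd (fst.comp hs)
  refine foldr hw (const ([], [])) (ite ((of_inputSym p).comp snd)
    ((const []).pair (cons hc (snd.comp hs))) (hc.pair (snd.comp hs))) ⟨Q + 3, fun c s x hx => ?_⟩
  have := hQ c x hx
  obtain ⟨s₁, s₂⟩ := s
  simp only [Polynomial.eval_add, Polynomial.eval_ofNat]
  split <;> simp only [size_pair, size_cons, size_nil] <;> omega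

theorem polyTime_negWord : PolyTime negWord :=
  (listCases (g := fun _ s t => s.neg :: t) id (const [])
    (cons ((of_inputSym InputSym.neg).comp (fst.comp snd)) (snd.comp snd))).congr fun w => by
      cases w <;> rfl

theorem polyTime_litWords {names : γ → List (List InputSym)} {entries : γ → List InputSym}
    (hn : PolyTime names) (he : PolyTime entries) :
    PolyTime fun c => litWords (names c) (entries c) := by
  refine flatMap (zip hn he) (inputSymCases
    (s := fun p : γ × List InputSym × InputSym => p.2.2)
    (f := fun x p => match x with
      | .bit b => [InputSym.sign b :: p.2.1]
      | _ => []) (snd.comp snd) fun x => ?_)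
  cases x with
  | bit b => exact cons (cons (const _) (fst.comp snd)) (const [])
  | _ => exact const []

theorem polyTime_sections {w : γ → List InputSym} (hw : PolyTime w) :
    PolyTime fun c => sections (w c) :=
  map (f := fun _ => List.tail) (snd.comp (polyTime_splitBefore _ hw)) snd.tail

theorem polyTime_parseIssues {w : γ → List InputSym} (hw : PolyTime w) :
    PolyTime fun c => parseIssues (w c) :=
  map (f := fun _ => List.tail) (snd.comp (polyTime_splitBefore _
    (fst.comp (polyTime_splitBefore _ hw)))) snd.tail

theorem polyTime_parseConstraint {w : γ → List InputSym} (hw : PolyTime w) :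
    PolyTime fun c => parseConstraint (w c) :=
  map (f := fun _ c => (splitBefore InputSym.isSign c).2)
    (snd.comp (polyTime_splitBefore _ ((polyTime_sections hw).headD (const []))))
    (snd.comp (polyTime_splitBefore _ snd))

theorem polyTime_parseTieBreak {w : γ → List InputSym} (hw : PolyTime w) :
    PolyTime fun c => parseTieBreak (w c) :=
  snd.comp (polyTime_splitBefore _ ((polyTime_sections hw).tail.headD (const [])))

theorem polyTime_parseProfile {w : γ → List InputSym} (hw : PolyTime w) :
    PolyTime fun c => parseProfile (w c) := by
  have hs : PolyTime fun c => (sections (w c)).tail.tail.headD [] :=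
    (polyTime_sections hw).tail.tail.headD (const [])
  have hl : PolyTime fun c => (splitBefore (fun x => decide (x = .ballot))
      ((sections (w c)).tail.tail.headD [])).2 := snd.comp (polyTime_splitBefore _ hs)
  have hf : PolyTime fun p : γ × List InputSym => litWords (parseIssues (w p.1)) p.2.tail :=
    polyTime_litWords (polyTime_parseIssues (hw.comp fst)) snd.tail
  exact map (f := fun (c : γ) (r : List InputSym) => litWords (parseIssues (w c)) r.tail) hl hf

theorem polyTime_parseTarget {w : γ → List InputSym} (hw : PolyTime w) :
    PolyTime fun c => parseTarget (w c) :=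
  polyTime_litWords (polyTime_parseIssues hw)
    ((polyTime_sections hw).tail.tail.tail.headD (const []))

theorem polyTime_decideOutcome : PolyTime decideOutcome :=
  have he : PolyTime fun p : List InputSym × List InputSym => decide (p.1 = p.2) :=
    listEq inputSymEq fst snd
  UnitPropagation.polyTime_answer he polyTime_negWord (polyTime_parseConstraint id)
    (UnitPropagation.polyTime_ranked he (polyTime_parseTieBreak id) (polyTime_parseProfile id))
    (polyTime_parseTarget id)

end

/-! ### From programs to Turing machines -/

section

open TreeCode StackProg WorkProg

noncomputable instance (k : WorkStack) : Fintype k.Alphabet := by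
  cases k <;> infer_instance

theorem size_inputSym_le (s : InputSym) : size s ≤ 15 := by
  have h₁ := size_bool_le s.toBits.1
  have h₂ := size_bool_le s.toBits.2.1
  have h₃ := size_bool_le s.toBits.2.2.1
  have h₄ := size_bool_le s.toBits.2.2.2
  have h : size s = size s.toBits := rfl
  rw [h, show s.toBits = (s.toBits.1, s.toBits.2.1, s.toBits.2.2.1, s.toBits.2.2.2) from rfl,
    size_pair, size_pair, size_pair]
  omega

theorem size_list_inputSym_le (w : List InputSym) : size w ≤ 16 * w.length + 1 := by
  induction w with
  | nil => simp
  | cons s w ih =>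
    have := size_inputSym_le s
    rw [size_cons, List.length_cons]
    omega

/-- Move the symbols from the input stack to the list on top of the main stack. -/
def readInputLoop : WorkProg :=
  loop .input Option.isSome (pop .input fun
    | some s => seq (pushAll (word s)) (push .main true)
    | none => skip)

theorem runs_readInputLoop (w acc : List InputSym) :
    Runs readInputLoop (contents w (word acc) (fun _ => []) [])
      (onMain (word (w.reverse ++ acc))) (19 * w.length + 1) := by
  induction w generalizing acc with
  | nil => exact (Runs.loop_false rfl).mono (by simp)
  | cons s w ih =>
    have h : Runs (pop .input fun
        | some s => seq (pushAll (word s)) (push .main true)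
        | none => skip) (contents (s :: w) (word acc) (fun _ => []) [])
        (contents w (word (s :: acc)) (fun _ => []) []) (size s + 1 + 1 + 1) :=
      .pop (by
        rw [contents_input, update_contents_input]
        exact (runs_pushAll (word s)).seq runs_push_main)
    rw [List.reverse_cons, List.append_assoc]
    refine (Runs.loop_true rfl h (ih (s :: acc))).mono ?_
    have := size_inputSym_le s
    rw [List.length_cons]
    omega

/-- Replace the word of a truth value by the truth value itself. -/
def writeOutput : WorkProg :=
  pop .main fun
    | some true => pop .main fun _ => pop .main fun _ => push .main true
    | _ => push .main false

theorem runs_writeOutput (b : Bool) : Runs writeOutput (onMain (word b)) (onMain [b]) 4 := by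
  cases b
  · exact (runs_pop_main (b := false) runs_push_main).mono (by norm_num)
  · exact runs_pop_main (b := true) (runs_pop_main (runs_pop_main runs_push_main))

/-- A question that is decided by a function computable in polynomial time is solved by a Turing
machine in polynomial time. -/
theorem polyTimeSolvable_of_polyTime {α : Type} {enc : α → List InputSym} {Q : α → Prop}
    {f : List InputSym → Bool} (hf : PolyTime f) (h : ∀ a, f (enc a) = true ↔ Q a) :
    PolyTimeSolvable enc Q := by
  classical
  -- The input is read in reverse.
  obtain ⟨p, P, hp⟩ := hf.comp (PolyTime.reverse PolyTime.id)
  let q : WorkProg := seq (push .main false) (seq readInputLoop (seq p writeOutput))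
  let T : Polynomial ℕ :=
    P.comp (16 * Polynomial.X + 1) + (19 * Polynomial.X + 7)
  have hq (a : α) : Nonempty (Turing.TM2OutputsInTime (machine q .input .main) (enc a)
      (some [decide (Q a)]) (T.eval (enc a).length)) := by
    have hQ : f (enc a).reverse.reverse = decide (Q a) := by
      rw [List.reverse_reverse, Bool.eq_iff_iff, h a, decide_eq_true_iff]
    have h₁ : Runs p _ (onMain (word (f (enc a).reverse.reverse) ++ [])) _ :=
      hp (enc a).reverse []
    have h₂ := runs_readInputLoop (enc a) []
    rw [hQ, List.append_nil, List.append_nil] at h₁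
    rw [List.append_nil] at h₂
    have h₃ := runs_push_main (b := false) (i := enc a) (m := []) (x := fun _ => []) (c := [])
    have h₄ := h₃.seq (h₂.seq (h₁.seq (runs_writeOutput (decide (Q a)))))
    have e₁ : contents (enc a) [] (fun _ => []) [] =
        Function.update (fun k : WorkStack => ([] : List k.Alphabet)) .input (enc a) := by
      funext k; cases k <;> rfl
    have e₂ : onMain [decide (Q a)] =
        Function.update (fun k : WorkStack => ([] : List k.Alphabet)) .main [decide (Q a)] := by
      funext k; cases k <;> rfl
    rw [e₁, e₂] at h₄
    refine h₄.machine_outputs ?_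
    have : P.eval (size (enc a).reverse) ≤ P.eval (16 * (enc a).length + 1) :=
      P.monotone_eval_nat (by
        simpa using size_list_inputSym_le (enc a).reverse)
    simp only [T, Polynomial.eval_add, Polynomial.eval_comp, Polynomial.eval_mul,
      Polynomial.eval_ofNat, Polynomial.eval_X, Polynomial.eval_one]
    omega
  exact ⟨{
    tm := machine q .input .main
    inputAlphabet := Equiv.refl InputSym
    outputAlphabet := Equiv.refl Bool
    time := T
    outputsFun := fun a => by
      have e : (enc a).map (Equiv.refl InputSym).invFun = enc a := List.map_id _
      exact cast (congrArg (fun w => Turing.TM2OutputsInTime (machine q .input .main) w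
        (some [decide (Q a)]) (T.eval (enc a).length)) e.symm) (hq a).some }⟩

end

theorem mainTheorem3 (C : Set CNF) (hC : C = Krom ∨ C = Horn) :
    PolyTimeSolvable (α := {I : OutcomeInstance // I.constraint ∈ C})
      (fun I => I.1.encode) (fun I => OutcomeTideman I.1) :=
  polyTimeSolvable_of_polyTime polyTime_decideOutcome fun I =>
    decideOutcome_encode I.1 (hC.imp (fun h : C = Krom => h ▸ I.2) fun h : C = Horn => h ▸ I.2)
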